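/- Let $\Lambda_\infty$ be the category whose objects $[m]$ are indexed by the positive integers $m$, and whose morphisms $[m]\to[n]$ are the (weakly) order-preserving maps $f:\mathbb Z\to\mathbb Z$ with $f(a+m)=f(a)+n$ for all $a$; let $\sigma:[m]\to[m]$ be $a\mapsto a+m$. For an integer $p\ge 1$ let $\Lambda_p$ be the category with the same objects and with $\Lambda_p([m],[n])=\Lambda_\infty([m],[n])/(f\sim f\circ\sigma^p)$, and put $\Lambda=\Lambda_1$. Let $i_p:\Lambda_p\to\Lambda$ be the functor $[m]\mapsto[mp]$ that sends the class of a map $f:\mathbb Z\to\mathbb Z$ to the class of the same map. In the abelian category $\mathrm{Fun}(\Lambda_p,\mathbb Z\text{-mod})$ of covariant functors, let $\mathbb Z$ be the constant functor, let $\mathbb Z_{[1]}$ be the functor sending $[n]$ to the free abelian group spanned by $\Lambda_p([1],[n])$, and let $\mathbb Z^o_{[1]}$ be the functor sending $[n]$ to the group of $\mathbb Z$-valued functions on $\Lambda_p([n],[1])$. Let $\mathbb Z\to\mathbb Z^o_{[1]}$ be the inclusion of constant functions and $\mathbb Z_{[1]}\to\mathbb Z$ the map sending every generator to $1$. Let $H^\bullet(\Lambda_p,\mathbb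 Z)=\mathrm{Ext}^\bullet(\mathbb Z,\mathbb Z)=\bigoplus_{n\ge 0}\mathrm{Ext}^n(\mathbb Z,\mathbb Z)$, the $\mathrm{Ext}$ groups being taken in $\mathrm{Fun}(\Lambda_p,\mathbb Z\text{-mod})$, with the Yoneda product. Then there exist maps $B_p:\mathbb Z^o_{[1]}\to\mathbb Z_{[1]}$, one for each $p\ge1$, such that for every $p\ge 1$: 1. the sequence $$0\longrightarrow\mathbb Z\longrightarrow\mathbb Z^o_{[1]}\xrightarrow{\ B_p\ }\mathbb Z_{[1]}\longrightarrow\mathbb Z\longrightarrow 0$$ is exact in $\mathrm{Fun}(\Lambda_p,\mathbb Z\text{-mod})$; 2. if $u(p)\in H^2(\Lambda_p,\mathbb Z)=\mathrm{Ext}^2(\mathbb Z,\mathbb Z)$ denotes the class represented by this exact sequence, then $H^\bullet(\Lambda_p,\mathbb Z)$ is the free algebra $\mathbb Z[u]$ on the generator $u=u(p)$, that is, the algebra map $\mathbb Z[u]\to H^\bullet(\Lambda_p,\mathbb Z)$, $u\mapsto u(p)$, is an isomorphism; 3. the algebra map $i_p^*:H^\bullet(\Lambda,\mathbb Z)\to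 H^\bullet(\Lambda_p,\mathbb Z)$ induced by restriction along $i_p$ sends $u(1)$ to $u(p)$. -/

import Mathlib

open CategoryTheory CategoryTheory.Limits CategoryTheory.Abelian

noncomputable section

namespace Paracyclic

/-! ## Two-fold Yoneda extensions -/

section Yoneda

universe w v u

variable {C : Type u} [Category.{v} C] [Abelian C]

/-- The sequence `0 ⟶ A ⟶ X ⟶ Y ⟶ B ⟶ 0` is exact. -/
structure IsExactSequence {A X Y B : C} (i : A ⟶ X) (d : X ⟶ Y) (q : Y ⟶ B) : Prop where
  mono : Mono i
  zero₁ : i ≫ d = 0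
  exact₁ : (ShortComplex.mk i d zero₁).Exact
  zero₂ : d ≫ q = 0
  exact₂ : (ShortComplex.mk d q zero₂).Exact
  epi : Epi q

namespace IsExactSequence

variable {A X Y B : C} {i : A ⟶ X} {d : X ⟶ Y} {q : Y ⟶ B} (h : IsExactSequence i d q)

/-- The left half `A ⟶ X ⟶ ker q` of the exact sequence. -/
def leftComplex : ShortComplex C :=
  ShortComplex.mk i (kernel.lift q d h.zero₂) (by
    rw [← cancel_mono (kernel.ι q)]
    simp [h.zero₁])

/-- The right half `ker q ⟶ Y ⟶ B` of the exact sequence. -/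
def rightComplex (_ : IsExactSequence i d q) : ShortComplex C :=
  ShortComplex.mk (kernel.ι q) q (kernel.condition q)

lemma leftComplex_shortExact : h.leftComplex.ShortExact := by
  have hf : Mono h.leftComplex.f := h.mono
  have hg : Epi h.leftComplex.g := h.exact₂.epi_kernelLift
  have he : h.leftComplex.Exact := by
    let φ : h.leftComplex ⟶ ShortComplex.mk i d h.zero₁ :=
      { τ₁ := 𝟙 A
        τ₂ := 𝟙 X
        τ₃ := kernel.ι q
        comm₁₂ := by simp [leftComplex]
        comm₂₃ := by simp [leftComplex] }
    have e1 : Epi φ.τ₁ := inferInstanceAs (Epi (𝟙 A))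
    have e2 : IsIso φ.τ₂ := inferInstanceAs (IsIso (𝟙 X))
    have e3 : Mono φ.τ₃ := inferInstanceAs (Mono (kernel.ι q))
    exact (ShortComplex.exact_iff_of_epi_of_isIso_of_mono φ).2 h.exact₁
  exact { exact := he, mono_f := hf, epi_g := hg }

lemma rightComplex_shortExact : h.rightComplex.ShortExact := by
  have hf : Mono h.rightComplex.f := inferInstanceAs (Mono (kernel.ι q))
  have hg : Epi h.rightComplex.g := h.epi
  exact
    { exact := ShortComplex.exact_of_f_is_kernel _ (kernelIsKernel q)
      mono_f := hf
      epi_g := hg }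

/-- The class in `Ext² (B, A)` that represents, by Yoneda, the exact sequence
`0 ⟶ A ⟶ X ⟶ Y ⟶ B ⟶ 0`: the product of the class of `0 ⟶ ker q ⟶ Y ⟶ B ⟶ 0` in
`Ext¹ (B, ker q)` and of the class of `0 ⟶ A ⟶ X ⟶ ker q ⟶ 0` in `Ext¹ (ker q, A)`. -/
def yonedaClass [HasExt.{w} C] : Ext.{w} B A 2 :=
  Ext.comp (Y := kernel q) h.rightComplex_shortExact.extClass h.leftComplex_shortExact.extClass rfl

end IsExactSequence

end Yoneda

/-! ## The graded ring `Ext^• (X, X)` -/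

section ExtRing

universe w v u

variable {C : Type u} [Category.{v} C] [Abelian C] [HasExt.{w} C] (X : C)

/-- The degree-`n` part `Extⁿ (X, X)` of the Yoneda algebra of `X`. -/
def SelfExt (n : ℕ) : Type w := Ext.{w} X X n

instance (n : ℕ) : AddCommGroup (SelfExt.{w} X n) := inferInstanceAs (AddCommGroup (Ext X X n))

variable {X} in
lemma gradedMk_comp {a b c : ℕ} (α : Ext.{w} X X a) (β : Ext.{w} X X b) (h : a + b = c) :
    (⟨a + b, α.comp β rfl⟩ : GradedMonoid (SelfExt.{w} X)) = ⟨c, α.comp β h⟩ := by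
  subst h
  rfl

instance : GradedMonoid.GMul (SelfExt.{w} X) where
  mul {a b} (α : Ext X X a) (β : Ext X X b) := (α.comp β rfl : Ext X X (a + b))

instance : GradedMonoid.GOne (SelfExt.{w} X) where
  one := Ext.mk₀ (𝟙 X)

instance : GradedMonoid.GMonoid (SelfExt.{w} X) where
  one_mul := by
    rintro ⟨n, α⟩
    exact (gradedMk_comp (Ext.mk₀ (𝟙 X)) α (zero_add n)).trans
      (congrArg (fun x => (⟨n, x⟩ : GradedMonoid (SelfExt.{w} X))) (Ext.mk₀_id_comp α))
  mul_one := by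
    rintro ⟨n, α⟩
    exact (gradedMk_comp α (Ext.mk₀ (𝟙 X)) (add_zero n)).trans
      (congrArg (fun x => (⟨n, x⟩ : GradedMonoid (SelfExt.{w} X))) (Ext.comp_mk₀_id α))
  mul_assoc := by
    rintro ⟨a, α⟩ ⟨b, β⟩ ⟨c, γ⟩
    refine (congrArg (fun x => (⟨a + b + c, x⟩ : GradedMonoid (SelfExt.{w} X)))
      (Ext.comp_assoc α β γ rfl rfl rfl)).trans ?_
    exact (gradedMk_comp α (β.comp γ rfl) (add_assoc a b c).symm).symm

/-- The graded ring structure given by the Yoneda product. -/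
instance : DirectSum.GRing (SelfExt.{w} X) where
  mul_zero {a b} (α : Ext X X a) := α.comp_zero X b (a + b) rfl
  zero_mul {a b} (β : Ext X X b) := Ext.zero_comp (n := a) X β (a + b) rfl
  mul_add {_ _} (α : Ext X X _) β γ := α.comp_add β γ rfl
  add_mul {_ _} (α : Ext X X _) β γ := Ext.add_comp α β γ rfl
  natCast n := (n • Ext.mk₀ (𝟙 X) : Ext X X 0)
  natCast_zero := zero_smul ℕ (Ext.mk₀ (𝟙 X) : Ext X X 0)
  natCast_succ n := succ_nsmul (Ext.mk₀ (𝟙 X) : Ext X X 0) n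
  intCast n := (n • Ext.mk₀ (𝟙 X) : Ext X X 0)
  intCast_ofNat n := natCast_zsmul (Ext.mk₀ (𝟙 X) : Ext X X 0) n
  intCast_negSucc_ofNat n := negSucc_zsmul (Ext.mk₀ (𝟙 X) : Ext X X 0) n

end ExtRing

/-! ## Functors from a small category to `ℤ`-modules -/

section SmallCategories

universe v u

variable (F : Type) [SmallCategory F]

/-- The category `Fun(F, ℤ-mod)`. -/
abbrev Fun : Type 1 := F ⥤ ModuleCat.{0} ℤ

instance : HasExt.{1} (Fun F) := HasExt.standard (Fun F)

/-- The constant functor with value `ℤ`. -/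
def constZ : Fun F := (Functor.const F).obj (ModuleCat.of ℤ ℤ)

variable {F}

/-- The functor `ℤ_[c]`, sending `d` to the free abelian group spanned by `Hom(c, d)`. -/
def lowerZ (c : F) : Fun F where
  obj d := ModuleCat.of ℤ ((c ⟶ d) →₀ ℤ)
  map g := ModuleCat.ofHom (Finsupp.lmapDomain ℤ ℤ (fun f => f ≫ g))
  map_id d := by
    ext : 1
    simp only [Category.comp_id]
    exact Finsupp.lmapDomain_id ℤ ℤ
  map_comp g g' := by
    ext : 1
    simp only [← Category.assoc, ModuleCat.hom_comp, ModuleCat.hom_ofHom]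
    exact Finsupp.lmapDomain_comp ℤ ℤ (fun f => f ≫ g) (fun f => f ≫ g')

/-- The functor `ℤ^o_[c]`, sending `d` to the abelian group of `ℤ`-valued functions on
`Hom(d, c)`. -/
def upperZ (c : F) : Fun F where
  obj d := ModuleCat.of ℤ ((d ⟶ c) → ℤ)
  map g := ModuleCat.ofHom (LinearMap.funLeft ℤ ℤ (fun f => g ≫ f))
  map_id d := by
    ext : 1
    simp only [Category.id_comp]
    rfl
  map_comp g g' := by
    ext : 1
    simp only [Category.assoc]
    rfl

/-- The universal property of `ℤ_[c]`, as the left Kan extension of `ℤ` along the inclusion of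
the object `c`. -/
def lowerZHomEquiv (c : F) (E : Fun F) : (lowerZ c ⟶ E) ≃ (ModuleCat.of ℤ ℤ ⟶ E.obj c) where
  toFun φ := ModuleCat.ofHom (Finsupp.lsingle (𝟙 c)) ≫ φ.app c
  invFun x :=
    { app := fun d => ModuleCat.ofHom
        (Finsupp.linearCombination ℤ (fun f : c ⟶ d => (E.map f).hom (x.hom (1 : ℤ))))
      naturality := by
        intro d d' g
        ext : 1
        refine Finsupp.lhom_ext fun f n => ?_
        simp [lowerZ] }
  left_inv φ := by
    ext d : 3
    refine Finsupp.lhom_ext fun f n => ?_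
    have h : (φ.app d).hom (Finsupp.mapDomain (fun k => k ≫ f) (Finsupp.single (𝟙 c) (1 : ℤ))) =
        (E.map f).hom ((φ.app c).hom (Finsupp.single (𝟙 c) (1 : ℤ))) :=
      congrArg (fun k => k.hom (Finsupp.single (𝟙 c) (1 : ℤ))) (φ.naturality f)
    rw [Finsupp.mapDomain_single, Category.id_comp] at h
    refine (Finsupp.linearCombination_single ℤ n f).trans ?_
    refine (congrArg (fun y : E.obj d => (E.obj d).isModule.toSMul.smul n y) h.symm).trans ?_
    refine ((φ.app d).hom.map_smul n (Finsupp.single f (1 : ℤ))).symm.trans ?_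
    exact congrArg (φ.app d).hom ((Finsupp.smul_single n f (1 : ℤ)).trans (by simp))
  right_inv x := by
    ext
    refine (congrArg (Finsupp.linearCombination ℤ _) (Finsupp.lsingle_apply _ _)).trans ?_
    refine (Finsupp.linearCombination_single ℤ (1 : ℤ) (𝟙 c)).trans ?_
    refine ((E.obj c).isModule.one_smul _).trans ?_
    simp

/-- The universal property of `ℤ^o_[c]`, as the right Kan extension of `ℤ` along the inclusion of
the object `c`. -/
def upperZHomEquiv (c : F) (E : Fun F) : (E ⟶ upperZ c) ≃ (E.obj c ⟶ ModuleCat.of ℤ ℤ) where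
  toFun φ := φ.app c ≫ ModuleCat.ofHom (LinearMap.proj (𝟙 c))
  invFun x :=
    { app := fun d => ModuleCat.ofHom
        (LinearMap.pi (fun f : d ⟶ c => (E.map f ≫ x).hom))
      naturality := by
        intro d d' g
        ext y
        funext f
        change x.hom ((E.map f).hom ((E.map g).hom y)) = x.hom ((E.map (g ≫ f)).hom y)
        simp }
  left_inv φ := by
    ext d y
    funext f
    have h := congrFun (congrArg (fun k => k.hom y) (φ.naturality f)) (𝟙 c)
    refine h.trans ?_
    change (φ.app d).hom y (f ≫ 𝟙 c) = _
    rw [Category.comp_id]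
  right_inv x := by
    ext y
    change x.hom ((E.map (𝟙 c)).hom y) = x.hom y
    simp

/-- The canonical map `ℤ_[c] ⟶ ℤ` given by adjunction. -/
def augmentation (c : F) : lowerZ c ⟶ constZ F :=
  (lowerZHomEquiv c (constZ F)).symm (𝟙 (ModuleCat.of ℤ ℤ))

lemma augmentation_single (c d : F) (f : c ⟶ d) (n : ℤ) :
    ((augmentation c).app d).hom (Finsupp.single f n) = n :=
  (Finsupp.linearCombination_single ℤ n f).trans (mul_one n)

/-- The canonical map `ℤ ⟶ ℤ^o_[c]` given by adjunction. -/
def coaugmentation (c : F) : constZ F ⟶ upperZ c :=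
  (upperZHomEquiv c (constZ F)).symm (𝟙 (ModuleCat.of ℤ ℤ))

lemma coaugmentation_apply (c d : F) (n : ℤ) :
    ((coaugmentation c).app d).hom n = fun _ : d ⟶ c => n := rfl

/-- The cohomology algebra `H^•(F, ℤ) = Ext^•(ℤ, ℤ)`, with the Yoneda product. -/
abbrev cohomologyRing (F : Type) [SmallCategory F] : Type 1 :=
  DirectSum ℕ (SelfExt.{1} (constZ F))

/-- The inclusion of `Hⁿ(F, ℤ) = Extⁿ(ℤ, ℤ)` into `H^•(F, ℤ)`. -/
def ofDegree {F : Type} [SmallCategory F] (n : ℕ) (x : Ext.{1} (constZ F) (constZ F) n) :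
    cohomologyRing F :=
  DirectSum.of (SelfExt.{1} (constZ F)) n x

variable {G : Type} [SmallCategory G]

/-- The restriction functor `ρ^*`, precomposition with `ρ`. -/
abbrev restriction (ρ : F ⥤ G) : Fun G ⥤ Fun F :=
  (Functor.whiskeringLeft F G (ModuleCat.{0} ℤ)).obj ρ

/-- The map `ρ^* : Hⁿ(G, ℤ) → Hⁿ(F, ℤ)` induced by the exact functor `ρ^*`, which sends the
constant functor `ℤ` to the constant functor `ℤ`. -/
def restrictExt (ρ : F ⥤ G) (n : ℕ) :
    SelfExt.{1} (constZ G) n →+ SelfExt.{1} (constZ F) n :=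
  (restriction ρ).mapExtAddHom (constZ G) (constZ G) n

/-- The algebra map `ρ^* : H^•(G, ℤ) → H^•(F, ℤ)`. -/
def restrictCohomology (ρ : F ⥤ G) : cohomologyRing G →+* cohomologyRing F :=
  DirectSum.toSemiring
    (fun n => (DirectSum.of (SelfExt.{1} (constZ F)) n).comp (restrictExt ρ n))
    (congrArg (DirectSum.of (SelfExt.{1} (constZ F)) 0)
      (Ext.mapExactFunctor_mk₀ (restriction ρ) (𝟙 (constZ G))))
    (fun {i j} (α : Ext _ _ i) (β : Ext _ _ j) =>
      (congrArg (DirectSum.of (SelfExt.{1} (constZ F)) (i + j))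
        (Ext.mapExactFunctor_comp (restriction ρ) α β rfl)).trans
        (DirectSum.of_mul_of (A := SelfExt.{1} (constZ F)) _ _).symm)

end SmallCategories

/-! ## The paracyclic categories -/

/-- Morphisms from `[m]` to `[n]` in `Λ_∞`: order-preserving maps `f : ℤ → ℤ` such that
`f (a + m) = f a + n`. -/
@[ext]
structure InfHom (m n : ℕ+) where
  toFun : ℤ → ℤ
  monotone : Monotone toFun
  map_add : ∀ a : ℤ, toFun (a + (m : ℤ)) = toFun a + (n : ℤ)

namespace InfHom

lemma map_add_mul {m n : ℕ+} (f : InfHom m n) (a k : ℤ) :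
    f.toFun (a + k * (m : ℤ)) = f.toFun a + k * (n : ℤ) := by
  induction k using Int.induction_on with
  | zero => simp
  | succ k ih =>
    have h := f.map_add (a + k * (m : ℤ))
    rw [ih] at h
    rw [show a + ((k : ℤ) + 1) * (m : ℤ) = a + k * (m : ℤ) + m by ring, h]
    ring
  | pred k ih =>
    have h := f.map_add (a + (-(k : ℤ) - 1) * (m : ℤ))
    rw [show a + (-(k : ℤ) - 1) * (m : ℤ) + m = a + -(k : ℤ) * m by ring, ih] at h
    linarith

/-- The identity of `[m]`. -/
def id (m : ℕ+) : InfHom m m := ⟨fun a => a, monotone_id, fun _ => rfl⟩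

/-- Composition, in diagrammatic order. -/
def comp {l m n : ℕ+} (f : InfHom l m) (g : InfHom m n) : InfHom l n :=
  ⟨fun a => g.toFun (f.toFun a), g.monotone.comp f.monotone, fun a => by
    rw [f.map_add, g.map_add]⟩

/-- The equivalence relation `f ∼ f ∘ σ^(pk)`, `k ∈ ℤ`, where `σ : [m] → [m]` is `a ↦ a + m`. -/
def setoid (p m n : ℕ+) : Setoid (InfHom m n) where
  r f g := ∃ k : ℤ, ∀ a : ℤ, g.toFun a = f.toFun (a + (p : ℤ) * k * (m : ℤ))
  iseqv :=
    { refl := fun f => ⟨0, fun a => by simp⟩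
      symm := by
        rintro f g ⟨k, h⟩
        refine ⟨-k, fun a => ?_⟩
        rw [h]
        congr 1
        ring
      trans := by
        rintro f g e ⟨k, h⟩ ⟨k', h'⟩
        refine ⟨k + k', fun a => ?_⟩
        rw [h', h]
        congr 1
        ring }

lemma comp_rel {p l m n : ℕ+} {f f' : InfHom l m} {g g' : InfHom m n}
    (hf : (setoid p l m).r f f') (hg : (setoid p m n).r g g') :
    (setoid p l n).r (f.comp g) (f'.comp g') := by
  obtain ⟨k, hk⟩ := hf
  obtain ⟨k', hk'⟩ := hg
  refine ⟨k + k', fun a => ?_⟩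
  simp only [comp, hk, hk', map_add_mul]
  ring

end InfHom

/-- The paracyclic category `Λ_p`; its objects `[m]` are the positive integers. -/
structure Lambda (p : ℕ+) : Type where
  len : ℕ+

/-- `Λ_p([m], [n]) = Λ_∞([m], [n]) / σ^p`. -/
instance (p : ℕ+) : SmallCategory (Lambda p) where
  Hom m n := Quotient (InfHom.setoid p m.len n.len)
  id m := Quotient.mk _ (InfHom.id m.len)
  comp f g := Quotient.map₂ InfHom.comp (fun _ _ hf _ _ hg => InfHom.comp_rel hf hg) f g
  id_comp := by
    rintro _ _ ⟨f⟩
    rfl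
  comp_id := by
    rintro _ _ ⟨f⟩
    rfl
  assoc := by
    rintro _ _ _ _ ⟨f⟩ ⟨g⟩ ⟨h⟩
    rfl

/-- A map `f : [m] → [n]` in `Λ_∞`, viewed as a map `[mp] → [np]`. -/
def InfHom.scale (p : ℕ+) {m n : ℕ+} (f : InfHom m n) : InfHom (m * p) (n * p) where
  toFun := f.toFun
  monotone := f.monotone
  map_add a := by
    have h := f.map_add_mul a (p : ℤ)
    push_cast
    rw [mul_comm (m : ℤ), mul_comm (n : ℤ)]
    exact h

/-- The functor `i_p : Λ_p ⥤ Λ = Λ_1`, `[m] ↦ [mp]`, which is the identity on maps `ℤ → ℤ`. -/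
def cyclicEmbedding (p : ℕ+) : Lambda p ⥤ Lambda 1 where
  obj m := ⟨m.len * p⟩
  map f := Quotient.map (InfHom.scale p) (by
    rintro f g ⟨k, h⟩
    refine ⟨k, fun a => ?_⟩
    simp only [InfHom.scale, h]
    congr 1
    push_cast
    ring) f
  map_id _ := rfl
  map_comp := by
    rintro _ _ _ ⟨f⟩ ⟨g⟩
    rfl

/-- The object `[1]` of `Λ_p`. -/
def objOne (p : ℕ+) : Lambda p := ⟨1⟩

end Paracyclic

end

noncomputable section

/-! An object `[m]` of `Λ_p` is a circle cut into `pm` unit edges: the morphisms `[1] ⟶ [m]` are its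
vertices `x ∈ ℤ/pm`, the morphisms `[m] ⟶ [1]` its edges `s ∈ ℤ/pm`, where the edge `s` runs from `s
- 1` to `s`. A morphism `g` carries the edge `s` to the path of all edges `t` with `g (s - 1) < t ≤
g s`. So `ℤ^o_[1]` is the functor of 1-chains, `ℤ_[1]` the functor of 0-chains, `B_p` (`connes`) the
boundary, and exactness is the homology of a circle.

By Yoneda `ℤ_[1]` is projective. The main point is that `Ext^n (ℤ^o_[1], ℤ) = 0` for every `n`,
including `0` (`subsingleton_ext_upperZ`). Splitting the sequence into two short exact ones then
shows that the product with `u` is bijective `Ext^n (ℤ, ℤ) → Ext^(n+2) (ℤ, ℤ)` and that `Ext^1 (ℤ,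
ℤ) = 0`; as `Ext^0 (ℤ, ℤ) = ℤ`, the algebra is `ℤ[u]`.

For the acyclicity, `ℤ^o_[1]` is the right Kan extension of `ℤ` along `Λ_p / [1] ⥤ Λ_p`. This Kan
extension is a pointwise product, hence exact, so by dimension shifting it is enough to know the
images of free functors. The image of the free functor on the standard edge of `[j]` has at `[m]` a
basis of pairs `(f, e)`: a chain `f` of `j` vertices and an edge `e` in the gap after its last
point. Send `(f, e)` to `f` with the end point of `e` added, minus `f` with its starting point
added; this makes the image a retract of `ℤ_[j+1]`, the retraction summing the edges between the
last two points of a chain (`retraction_sectionComponent`). So the image is projective. It has no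
nonzero map to `ℤ`: merging the last two points does not change the value of a map to a constant
functor, but makes that sum empty (`overRan_freeOver_hom_constZ`).

Finally `i_p` identifies the circle `[m]` of `Λ_p` with the circle `[mp]` of `Λ`, compatibly with
vertices, edges and boundaries. -/

namespace Paracyclic

/-! ### Yoneda classes and dimension shifting -/

section Abelian

universe w w' v v' u u'

variable {C : Type u} [Category.{v} C] [Abelian C] [HasExt.{w} C]

/-- An exact functor followed by a morphism of exact sequences that is the identity at both ends
preserves Yoneda classes. -/
lemma IsExactSequence.mapExactFunctor_yonedaClass {D : Type u'} [Category.{v'} D] [Abelian D]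
    [HasExt.{w'} D] (F : C ⥤ D) [F.Additive] [PreservesFiniteLimits F]
    [PreservesFiniteColimits F] {A X Y B : C} {i : A ⟶ X} {d : X ⟶ Y} {q : Y ⟶ B}
    (h : IsExactSequence i d q) {X' Y' : D} {i' : F.obj A ⟶ X'} {d' : X' ⟶ Y'}
    {q' : Y' ⟶ F.obj B} (h' : IsExactSequence i' d' q') (a : F.obj X ⟶ X') (b : F.obj Y ⟶ Y')
    (hi : F.map i ≫ a = i') (hd : a ≫ d' = F.map d ≫ b) (hq : b ≫ q' = F.map q) :
    h.yonedaClass.mapExactFunctor F = h'.yonedaClass := by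
  let κ : F.obj (kernel q) ⟶ kernel q' := kernel.lift q' (F.map (kernel.ι q) ≫ b) (by
    rw [Category.assoc, hq, ← F.map_comp, kernel.condition, F.map_zero])
  have hκ : κ ≫ kernel.ι q' = F.map (kernel.ι q) ≫ b := kernel.lift_ι _ _ _
  let φ : h.rightComplex.map F ⟶ h'.rightComplex :=
    { τ₁ := κ
      τ₂ := b
      τ₃ := 𝟙 _
      comm₁₂ := hκ
      comm₂₃ := hq.trans (Category.comp_id _).symm }
  let ψ : h.leftComplex.map F ⟶ h'.leftComplex :=
    { τ₁ := 𝟙 _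
      τ₂ := a
      τ₃ := κ
      comm₁₂ := (Category.id_comp _).trans hi.symm
      comm₂₃ := by
        refine (cancel_mono (kernel.ι q')).1 ?_
        change (a ≫ kernel.lift q' d' h'.zero₂) ≫ kernel.ι q' =
          (F.map (kernel.lift q d h.zero₂) ≫ κ) ≫ kernel.ι q'
        rw [Category.assoc, Category.assoc, hκ, kernel.lift_ι, ← Category.assoc, ← F.map_comp,
          kernel.lift_ι, hd] }
  -- Naturality says that the two right halves correspond under pushout along `κ` and the two left
  -- halves under pullback along `κ`; associativity moves `κ` from one factor to the other.
  have e₁ := ShortComplex.ShortExact.extClass_naturality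
    (h.rightComplex_shortExact.map_of_exact F) h'.rightComplex_shortExact φ
  have e₂ := ShortComplex.ShortExact.extClass_naturality
    (h.leftComplex_shortExact.map_of_exact F) h'.leftComplex_shortExact ψ
  have e₁' : (h.rightComplex_shortExact.map_of_exact F).extClass.comp (Ext.mk₀ κ) (add_zero 1) =
      h'.rightComplex_shortExact.extClass := e₁.trans (Ext.mk₀_id_comp _)
  have e₂' : (h.leftComplex_shortExact.map_of_exact F).extClass =
      (Ext.mk₀ κ).comp h'.leftComplex_shortExact.extClass (zero_add 1) :=
    (Ext.comp_mk₀_id _).symm.trans e₂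
  refine (Ext.mapExactFunctor_comp (Y := kernel q) F h.rightComplex_shortExact.extClass
    h.leftComplex_shortExact.extClass rfl).trans ?_
  refine (congrArg₂ (fun x y => Ext.comp (Y := F.obj (kernel q)) x y rfl)
    (Ext.mapExactFunctor_extClass F h.rightComplex_shortExact)
    ((Ext.mapExactFunctor_extClass F h.leftComplex_shortExact).trans e₂')).trans ?_
  refine (Ext.comp_assoc (Y := F.obj (kernel q)) (Z := kernel q') _ (Ext.mk₀ κ) _
    (add_zero 1) (zero_add 1) rfl).symm.trans ?_
  exact congrArg (fun x => Ext.comp (Y := kernel q') x h'.leftComplex_shortExact.extClass rfl) e₁'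

/-- The connecting map in the long exact sequence of `Ext (-, Z)`: `hn` gives injectivity, `hm`
surjectivity. -/
lemma extClass_comp_bijective {S : ShortComplex C} (hS : S.ShortExact) (Z : C) {n m : ℕ}
    (hnm : 1 + n = m) (hn : ∀ x : Ext.{w} S.X₂ Z n, (Ext.mk₀ S.f).comp x (zero_add n) = 0)
    (hm : Subsingleton (Ext.{w} S.X₂ Z m)) :
    Function.Bijective (fun x : Ext.{w} S.X₁ Z n => hS.extClass.comp x hnm) := by
  constructor
  · refine (injective_iff_map_eq_zero (hS.extClass.precomp Z hnm)).2 fun x hx => ?_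
    obtain ⟨y, rfl⟩ := Ext.contravariant_sequence_exact₁ hS Z x hnm hx
    exact hn y
  · intro x
    exact Ext.contravariant_sequence_exact₃ hS Z x (Subsingleton.elim _ _) hnm

lemma subsingleton_ext_zero_of_epi {X Y : C} (f : X ⟶ Y) [Epi f] (Z : C)
    (h : Subsingleton (Ext.{w} X Z 0)) : Subsingleton (Ext.{w} Y Z 0) :=
  (Ext.precomp_mk₀_injective_of_epi Z f).subsingleton

/-- Splicing: if `X` is `Z`-acyclic in all degrees and `Y` in positive degrees, then the Yoneda
product with the class of `0 ⟶ A ⟶ X ⟶ Y ⟶ B ⟶ 0` is bijective. -/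
lemma IsExactSequence.yonedaClass_comp_bijective {A X Y B : C} {i : A ⟶ X} {d : X ⟶ Y} {q : Y ⟶ B}
    (h : IsExactSequence i d q) (Z : C) (hX : ∀ n, Subsingleton (Ext.{w} X Z n))
    (hY : ∀ n, Subsingleton (Ext.{w} Y Z (n + 1))) (n m : ℕ) (hnm : 2 + n = m) :
    Function.Bijective (fun x : Ext.{w} A Z n => h.yonedaClass.comp x hnm) := by
  have h₁ := extClass_comp_bijective (n := n) (m := n + 1) h.leftComplex_shortExact Z (add_comm 1 n)
    (fun x => (congrArg (fun y => (Ext.mk₀ i).comp y (zero_add n))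
      ((hX n).elim x 0)).trans (Ext.comp_zero _ _ _ _ _)) (hX (n + 1))
  -- Only degrees `n + 1` and `n + 2` of `Y` enter, so `Hom (Y, Z)` may be nonzero.
  have h₂ := extClass_comp_bijective (n := n + 1) (m := m) h.rightComplex_shortExact Z (by omega)
    (fun x => (congrArg (fun y => (Ext.mk₀ (kernel.ι q)).comp y (zero_add (n + 1)))
      ((hY n).elim x 0)).trans (Ext.comp_zero _ _ _ _ _))
    (by obtain rfl : m = n + 1 + 1 := by omega
        exact hY (n + 1))
  have e : (fun x : Ext.{w} A Z n => h.yonedaClass.comp x hnm) = _ :=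
    funext fun x => Ext.comp_assoc (Y := kernel q) h.rightComplex_shortExact.extClass
      h.leftComplex_shortExact.extClass x rfl (add_comm 1 n) (by omega)
  exact e ▸ h₂.comp h₁

/-- A class that dies on `Y` comes from `Hom (ker q, Z)`, which vanishes because `ker q` is a
quotient of `X`. -/
lemma IsExactSequence.subsingleton_ext_one {A X Y B : C} {i : A ⟶ X} {d : X ⟶ Y} {q : Y ⟶ B}
    (h : IsExactSequence i d q) (Z : C) (hX : Subsingleton (Ext.{w} X Z 0))
    (hY : Subsingleton (Ext.{w} Y Z 1)) : Subsingleton (Ext.{w} B Z 1) := by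
  have : Epi h.leftComplex.g := h.leftComplex_shortExact.epi_g
  have hK : Subsingleton (Ext.{w} (kernel q) Z 0) :=
    subsingleton_ext_zero_of_epi h.leftComplex.g Z hX
  refine subsingleton_of_forall_eq 0 fun x => ?_
  obtain ⟨y, rfl⟩ := Ext.contravariant_sequence_exact₃ h.rightComplex_shortExact Z x
    (hY.elim _ _) (add_zero 1)
  rw [hK.elim y 0]
  exact Ext.comp_zero _ _ _ _ _

/-- Dimension shifting: a class of objects with no maps to `Z`, each of which is a quotient, by
an object of the class, of a projective object with no maps to `Z`, is `Z`-acyclic. -/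
lemma subsingleton_ext_of_resolving (Z : C) (𝒬 : C → Prop)
    (h : ∀ Q, 𝒬 Q → ∃ S : ShortComplex C, S.ShortExact ∧ 𝒬 S.X₁ ∧ Projective S.X₂ ∧
      (∀ f : S.X₂ ⟶ Z, f = 0) ∧ S.X₃ = Q) (n : ℕ) :
    ∀ Q, 𝒬 Q → Subsingleton (Ext.{w} Q Z n) := by
  have h0 (X : C) (hX : ∀ f : X ⟶ Z, f = 0) : Subsingleton (Ext.{w} X Z 0) :=
    subsingleton_of_forall_eq 0 fun x => Ext.addEquiv₀.injective (by
      rw [hX (Ext.addEquiv₀ x), map_zero])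
  induction n with
  | zero =>
    intro Q hQ
    obtain ⟨S, hS, -, -, hf, rfl⟩ := h Q hQ
    have := hS.epi_g
    exact subsingleton_ext_zero_of_epi S.g Z (h0 _ hf)
  | succ n ih =>
    intro Q hQ
    obtain ⟨S, hS, hQ', hP, hf, rfl⟩ := h Q hQ
    have := ih _ hQ'
    refine subsingleton_of_forall_eq 0 fun x => ?_
    obtain ⟨y, rfl⟩ := Ext.contravariant_sequence_exact₃ hS Z x (Ext.eq_zero_of_projective _)
      (add_comm 1 n)
    rw [Subsingleton.elim y 0]
    exact Ext.comp_zero _ _ _ _ _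

end Abelian

/-! ### Recognizing a polynomial Yoneda algebra -/

section PolynomialRing

universe w v u

variable {C : Type u} [Category.{v} C] [Abelian C] [HasExt.{w} C] {X : C}

lemma bijective_zsmul_comp {n m k : ℕ} (u : Ext.{w} X X n) (x : Ext.{w} X X m) (h : n + m = k)
    (hu : Function.Bijective (fun y : Ext.{w} X X m => u.comp y h))
    (hx : Function.Bijective (fun a : ℤ => a • x)) :
    Function.Bijective (fun a : ℤ => a • u.comp x h) := by
  have e : (fun a : ℤ => a • u.comp x h) = (fun y => u.comp y h) ∘ (fun a : ℤ => a • x) :=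
    funext fun a => (map_zsmul (u.precomp X h) a x).symm
  exact e ▸ hu.comp hx

/-- The power `u ^ k` freely spans degree `2k`. The degree is a variable `n` with `n = 2 * k`, so
that the degree `2 + 2 * k` of a product needs no cast. -/
lemma exists_pow_of_eq (u : SelfExt.{w} X 2)
    (hu : ∀ n m (h : 2 + n = m),
      Function.Bijective (fun x : Ext.{w} X X n => Ext.comp (a := 2) u x h))
    (h0 : Function.Bijective (fun a : ℤ => a • Ext.mk₀.{w} (𝟙 X))) (k : ℕ) :
    ∀ n, n = 2 * k → ∃ x : SelfExt.{w} X n,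
      DirectSum.of (SelfExt.{w} X) 2 u ^ k = DirectSum.of (SelfExt.{w} X) n x ∧
        Function.Bijective (fun a : ℤ => a • x) := by
  induction k with
  | zero =>
    rintro n rfl
    exact ⟨Ext.mk₀ (𝟙 X), pow_zero _, h0⟩
  | succ k ih =>
    intro n hn
    obtain ⟨x, hx, hb⟩ := ih _ rfl
    obtain rfl : n = 2 + 2 * k := by omega
    refine ⟨Ext.comp (a := 2) (b := 2 * k) u x rfl, ?_, ?_⟩
    · rw [pow_succ', hx]
      exact DirectSum.of_mul_of _ _
    · exact bijective_zsmul_comp u x rfl (hu _ _ rfl) hb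

lemma subsingleton_selfExt_odd (u : SelfExt.{w} X 2)
    (hu : ∀ n m (h : 2 + n = m),
      Function.Bijective (fun x : Ext.{w} X X n => Ext.comp (a := 2) u x h))
    (h1 : Subsingleton (Ext.{w} X X 1)) (k : ℕ) :
    ∀ n, n = 2 * k + 1 → Subsingleton (SelfExt.{w} X n) := by
  induction k with
  | zero =>
    rintro n rfl
    exact h1
  | succ k ih =>
    intro n hn
    have := ih _ rfl
    exact @Function.Surjective.subsingleton _ _ _ this (hu (2 * k + 1) n (by omega)).surjective

/-- If the product with `u` is bijective, `Ext⁰ (X, X)` is freely spanned by the identity and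
`Ext¹ (X, X)` vanishes, then `Ext^• (X, X)` is the polynomial ring on `u`. -/
lemma aeval_bijective_of_comp_bijective (u : SelfExt.{w} X 2)
    (hu : ∀ n m (h : 2 + n = m),
      Function.Bijective (fun x : Ext.{w} X X n => Ext.comp (a := 2) u x h))
    (h0 : Function.Bijective (fun a : ℤ => a • Ext.mk₀.{w} (𝟙 X)))
    (h1 : Subsingleton (Ext.{w} X X 1)) :
    Function.Bijective (Polynomial.aeval (R := ℤ) (DirectSum.of (SelfExt.{w} X) 2 u) :
      Polynomial ℤ → DirectSum ℕ (SelfExt.{w} X)) := by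
  choose x hx hb using fun k => exists_pow_of_eq u hu h0 k _ rfl
  constructor
  · rw [injective_iff_map_eq_zero]
    intro P hP
    ext k
    rw [Polynomial.coeff_zero]
    refine (hb k).injective (?_ : P.coeff k • x k = (0 : ℤ) • x k)
    rw [zero_smul]
    -- Distinct powers of `u` lie in distinct degrees, so the coefficients of `P` can be read off
    -- degree by degree.
    have h : DirectSum.component ℤ ℕ (SelfExt.{w} X) (2 * k)
        (Polynomial.aeval (R := ℤ) (DirectSum.of (SelfExt.{w} X) 2 u) P) = P.coeff k • x k := by
      rw [Polynomial.aeval_eq_sum_range, map_sum]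
      by_cases hk : k ∈ Finset.range (P.natDegree + 1)
      · rw [Finset.sum_eq_single_of_mem k hk]
        · rw [hx, map_zsmul]
          congr 1
          exact DirectSum.of_eq_same _ _
        · intro j _ hj
          rw [hx, map_zsmul, show DirectSum.component ℤ ℕ (SelfExt.{w} X) (2 * k)
            (DirectSum.of (SelfExt.{w} X) (2 * j) (x j)) = 0 from
              DirectSum.of_eq_of_ne _ _ _ (by omega), smul_zero]
      · rw [Finset.sum_eq_zero]
        · rw [Polynomial.coeff_eq_zero_of_natDegree_lt (by simpa using hk), zero_smul]
        · intro j hj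
          rw [hx, map_zsmul, show DirectSum.component ℤ ℕ (SelfExt.{w} X) (2 * k)
            (DirectSum.of (SelfExt.{w} X) (2 * j) (x j)) = 0 from
              DirectSum.of_eq_of_ne _ _ _ (by rintro h; obtain rfl : k = j := by omega
                                              exact hk hj), smul_zero]
    rw [← h, hP, map_zero]
  · intro y
    induction y using DirectSum.induction_on with
    | zero => exact ⟨0, map_zero _⟩
    | of n y =>
      obtain ⟨k, hk⟩ := Nat.even_or_odd' n
      rcases hk with rfl | rfl
      · obtain ⟨a, rfl⟩ := (hb k).surjective y
        refine ⟨a • Polynomial.X ^ k, ?_⟩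
        rw [map_zsmul, map_pow, Polynomial.aeval_X, hx]
        exact (map_zsmul (DirectSum.of (SelfExt.{w} X) (2 * k)) a (x k)).symm
      · have := subsingleton_selfExt_odd u hu h1 k _ rfl
        exact ⟨0, by rw [Subsingleton.elim y 0, map_zero, map_zero]⟩
    | add y z hy hz =>
      obtain ⟨P, rfl⟩ := hy
      obtain ⟨Q, rfl⟩ := hz
      exact ⟨P + Q, map_add _ _ _⟩

end PolynomialRing

/-- The module structure carried by an object of `ModuleCat ℤ`; it has to take precedence over the
one induced by the additive group. -/
@[reducible]
def carriedModule (M : ModuleCat.{0} ℤ) : Module ℤ M := M.isModule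

/-- The product of the carried module structures. -/
@[reducible]
def carriedPiModule {ι : Type} (M : ι → ModuleCat.{0} ℤ) : Module ℤ (∀ i, M i) :=
  Pi.module ι (fun i => M i) ℤ

attribute [local instance] carriedModule carriedPiModule

/-! ### Pointwise exactness, projectives and Kan extension in functor categories -/

section FunctorCategories

variable {C : Type} [SmallCategory C]

lemma fun_hom_ext {E E' : Fun C} {φ ψ : E ⟶ E'}
    (h : ∀ d (x : E.obj d), (φ.app d).hom x = (ψ.app d).hom x) : φ = ψ := by
  ext d x
  exact h d x

lemma naturality_apply {E E' : Fun C} (φ : E ⟶ E') {d d' : C} (g : d ⟶ d') (x : E.obj d) :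
    (φ.app d').hom ((E.map g).hom x) = (E'.map g).hom ((φ.app d).hom x) :=
  congrArg (fun k => k.hom x) (φ.naturality g)

lemma map_comp_apply (E : Fun C) {d d' d'' : C} (g : d ⟶ d') (g' : d' ⟶ d'') (x : E.obj d) :
    (E.map (g ≫ g')).hom x = (E.map g').hom ((E.map g).hom x) :=
  congrArg (fun k => k.hom x) (E.map_comp g g')

lemma map_id_apply (E : Fun C) {d : C} (x : E.obj d) : (E.map (𝟙 d)).hom x = x :=
  congrArg (fun k => k.hom x) (E.map_id d)

lemma epi_iff_surjective_app {E E' : Fun C} (φ : E ⟶ E') :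
    Epi φ ↔ ∀ d, Function.Surjective (φ.app d).hom := by
  rw [NatTrans.epi_iff_epi_app]
  exact forall_congr' fun d => ModuleCat.epi_iff_surjective _

lemma mono_iff_injective_app {E E' : Fun C} (φ : E ⟶ E') :
    Mono φ ↔ ∀ d, Function.Injective (φ.app d).hom := by
  rw [NatTrans.mono_iff_mono_app]
  exact forall_congr' fun d => ModuleCat.mono_iff_injective _

lemma isIso_of_bijective_app {E E' : Fun C} (φ : E ⟶ E')
    (h : ∀ d, Function.Bijective (φ.app d).hom) : IsIso φ := by
  have h₁ : Mono φ := (mono_iff_injective_app φ).2 fun d => (h d).1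
  have h₂ : Epi φ := (epi_iff_surjective_app φ).2 fun d => (h d).2
  exact isIso_of_mono_of_epi φ

/-- Evaluation at an object commutes with homology, and a functor vanishes when all its values do.
-/
lemma exact_iff_exact_app (S : ShortComplex (Fun C)) :
    S.Exact ↔ ∀ d (x : S.X₂.obj d), (S.g.app d).hom x = 0 → ∃ y, (S.f.app d).hom y = x := by
  have h (d : C) : (S.map ((evaluation C (ModuleCat.{0} ℤ)).obj d)).Exact ↔
      ∀ x : S.X₂.obj d, (S.g.app d).hom x = 0 → ∃ y, (S.f.app d).hom y = x :=
    ShortComplex.moduleCat_exact_iff _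
  refine ⟨fun hS d => (h d).1 (hS.map _), fun hS => ?_⟩
  rw [ShortComplex.exact_iff_isZero_homology]
  refine Functor.isZero _ fun d => ?_
  exact ((ShortComplex.exact_iff_isZero_homology _).1 ((h d).2 (hS d))).of_iso
    (S.mapHomologyIso ((evaluation C (ModuleCat.{0} ℤ)).obj d)).symm

/-- By Yoneda, maps out of `ℤ_[c]` are elements of the value at `c`, and evaluation at `c` preserves
epimorphisms. -/
instance projective_lowerZ (c : C) : Projective (lowerZ c) where
  factors {E E'} f e he := by
    have hc : Epi (e.app c) := (NatTrans.epi_iff_epi_app e).1 he c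
    have : Projective (ModuleCat.of ℤ ℤ) :=
      ModuleCat.projective_of_free (Module.Basis.singleton Unit ℤ)
    refine ⟨(lowerZHomEquiv c E).symm (Projective.factorThru (lowerZHomEquiv c E' f) (e.app c)), ?_⟩
    apply (lowerZHomEquiv c E').injective
    have h (φ : lowerZ c ⟶ E) : lowerZHomEquiv c E' (φ ≫ e) = lowerZHomEquiv c E φ ≫ e.app c := rfl
    rw [h, Equiv.apply_symm_apply, Projective.factorThru_comp]

/-! ### Free functors on families of objects -/

variable {I : Type}

/-- The direct sum of the functors `ℤ_[X i]`. -/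
def freeOn (X : I → C) : Fun C where
  obj d := ModuleCat.of ℤ ((Σ i, X i ⟶ d) →₀ ℤ)
  map g := ModuleCat.ofHom (Finsupp.lmapDomain ℤ ℤ (fun x => ⟨x.1, x.2 ≫ g⟩))
  map_id d := by
    ext : 1
    simp only [Category.comp_id]
    exact Finsupp.lmapDomain_id ℤ ℤ
  map_comp g g' := by
    ext : 1
    simp only [← Category.assoc, ModuleCat.hom_comp, ModuleCat.hom_ofHom]
    exact Finsupp.lmapDomain_comp ℤ ℤ (fun x : Σ i, X i ⟶ _ => (⟨x.1, x.2 ≫ g⟩ : Σ i, X i ⟶ _))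
      (fun x => (⟨x.1, x.2 ≫ g'⟩ : Σ i, X i ⟶ _))

namespace freeOn

variable {X : I → C}

/-- The basis element of `freeOn X` given by a morphism `f : X i ⟶ d`. -/
def basis {i : I} {d : C} (f : X i ⟶ d) : (freeOn X).obj d :=
  (Finsupp.single ⟨i, f⟩ 1 : (Σ i, X i ⟶ d) →₀ ℤ)

lemma map_basis {i : I} {d d' : C} (f : X i ⟶ d) (g : d ⟶ d') :
    ((freeOn X).map g).hom (basis f) = basis (f ≫ g) :=
  Finsupp.mapDomain_single

lemma linearMap_ext {d : C} {M : ModuleCat.{0} ℤ}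
    {φ ψ : (freeOn X).obj d →ₗ[ℤ] M} (h : ∀ i (f : X i ⟶ d), φ (basis f) = ψ (basis f)) :
    φ = ψ :=
  Finsupp.lhom_ext' fun x => LinearMap.ext_ring (h x.1 x.2)

/-- The linear map on `(freeOn X).obj d` with given values on the basis. -/
def lift {d : C} {M : ModuleCat.{0} ℤ} (m : ∀ i, (X i ⟶ d) → M) :
    (freeOn X).obj d →ₗ[ℤ] M :=
  Finsupp.linearCombination ℤ (fun x : Σ i, X i ⟶ d => m x.1 x.2)

lemma lift_basis {d : C} {M : ModuleCat.{0} ℤ} (m : ∀ i, (X i ⟶ d) → M)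
    {i : I} (f : X i ⟶ d) : lift m (basis f) = m i f :=
  (Finsupp.linearCombination_single ℤ (1 : ℤ) _).trans (M.isModule.one_smul _)

lemma hom_ext {E : Fun C} {φ ψ : freeOn X ⟶ E}
    (h : ∀ i, (φ.app (X i)).hom (basis (𝟙 (X i))) = (ψ.app (X i)).hom (basis (𝟙 (X i)))) :
    φ = ψ := by
  ext d : 3
  refine linearMap_ext fun i f => ?_
  have h' := congrArg (E.map f).hom (h i)
  rwa [← naturality_apply, ← naturality_apply, map_basis, Category.id_comp] at h'

/-- The map `freeOn X ⟶ E` given by elements of `E.obj (X i)`. -/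
def desc {E : Fun C} (m : ∀ i, E.obj (X i)) : freeOn X ⟶ E where
  app d := ModuleCat.ofHom (lift fun i f => (E.map f).hom (m i))
  naturality d d' g := by
    ext : 1
    refine linearMap_ext fun i f => ?_
    change lift (fun i f => (E.map f).hom (m i)) (((freeOn X).map g).hom (basis f)) =
      (E.map g).hom (lift (fun i f => (E.map f).hom (m i)) (basis f))
    rw [map_basis, lift_basis, lift_basis, map_comp_apply]

lemma desc_basis {E : Fun C} (m : ∀ i, E.obj (X i)) {i : I} {d : C} (f : X i ⟶ d) :
    ((desc m).app d).hom (basis f) = (E.map f).hom (m i) :=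
  lift_basis _ f

instance : Projective (freeOn X) where
  factors {E E'} f e he := by
    choose m hm using fun i => (epi_iff_surjective_app e).1 he (X i)
      ((f.app (X i)).hom (basis (𝟙 (X i))))
    refine ⟨desc m, hom_ext fun i => ?_⟩
    change (e.app (X i)).hom (((desc m).app (X i)).hom (basis (𝟙 (X i)))) = _
    rw [desc_basis, map_id_apply, hm]

end freeOn

/-! ### Right Kan extension along `Over c ⥤ C` -/

variable (c : C)

/-- The right Kan extension along the forgetful functor `Over c ⥤ C`. -/
def overRan : Fun (Over c) ⥤ Fun C where
  obj S :=
    { obj := fun m => ModuleCat.of ℤ (∀ e : m ⟶ c, S.obj (Over.mk e))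
      map := fun {m m'} g => ModuleCat.ofHom (LinearMap.pi fun e : m' ⟶ c =>
        (S.map (Over.homMk g : Over.mk (g ≫ e) ⟶ Over.mk e)).hom ∘ₗ LinearMap.proj (g ≫ e))
      map_id := by
        intro m
        ext y e
        change (S.map (Over.homMk (𝟙 m) : Over.mk (𝟙 m ≫ e) ⟶ Over.mk e)).hom (y (𝟙 m ≫ e)) = y e
        -- The object `Over.mk (𝟙 m ≫ e)` is only propositionally `Over.mk e`; a variable `e'`
        -- allows substitution.
        have h (e' : m ⟶ c) (he : e' = e) :
            (S.map (Over.homMk (𝟙 m) (by simp [he]) : Over.mk e' ⟶ Over.mk e)).hom (y e') = y e := by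
          subst he
          exact map_id_apply S (y e')
        exact h _ (Category.id_comp e)
      map_comp := by
        intro m m' m'' g g'
        ext y e
        change (S.map (Over.homMk (g ≫ g') : Over.mk ((g ≫ g') ≫ e) ⟶ Over.mk e)).hom
            (y ((g ≫ g') ≫ e)) =
          (S.map (Over.homMk g' : Over.mk (g' ≫ e) ⟶ Over.mk e)).hom
            ((S.map (Over.homMk g : Over.mk (g ≫ g' ≫ e) ⟶ Over.mk (g' ≫ e))).hom
              (y (g ≫ g' ≫ e)))
        have h (e' : m ⟶ c) (he : e' = g ≫ g' ≫ e) :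
            (S.map (Over.homMk (g ≫ g') (by simp [he]) : Over.mk e' ⟶ Over.mk e)).hom (y e') =
              (S.map (Over.homMk g' : Over.mk (g' ≫ e) ⟶ Over.mk e)).hom
                ((S.map (Over.homMk g : Over.mk (g ≫ g' ≫ e) ⟶ Over.mk (g' ≫ e))).hom
                  (y (g ≫ g' ≫ e))) := by
          subst he
          rw [← map_comp_apply]
          rfl
        exact h _ (Category.assoc _ _ _) }
  map φ :=
    { app := fun m => ModuleCat.ofHom (LinearMap.pi fun e : m ⟶ c =>
        (φ.app (Over.mk e)).hom ∘ₗ LinearMap.proj e)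
      naturality := by
        intro m m' g
        ext y e
        exact naturality_apply φ (Over.homMk g : Over.mk (g ≫ e) ⟶ Over.mk e) (y (g ≫ e)) }
  map_id _ := rfl
  map_comp _ _ := rfl

variable {c}

lemma overRan_map_apply (S : Fun (Over c)) {m m' : C} (g : m ⟶ m')
    (y : ∀ e : m ⟶ c, S.obj (Over.mk e))
    (e : m' ⟶ c) : ((((overRan c).obj S).map g).hom y : ∀ e : m' ⟶ c, S.obj (Over.mk e)) e =
      (S.map (Over.homMk g : Over.mk (g ≫ e) ⟶ Over.mk e)).hom (y (g ≫ e)) := rfl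

instance : (overRan c).Additive where
  map_add := rfl

/-- The values are products over the morphisms `m ⟶ c`, and products of modules are exact. -/
lemma shortExact_map_overRan {S : ShortComplex (Fun (Over c))} (hS : S.ShortExact) :
    (S.map (overRan c)).ShortExact := by
  have hf := (mono_iff_injective_app _).1 hS.mono_f
  have hg := (epi_iff_surjective_app _).1 hS.epi_g
  have he := (exact_iff_exact_app S).1 hS.exact
  refine { exact := (exact_iff_exact_app _).2 fun m x hx => ?_, mono_f := ?_, epi_g := ?_ }
  · choose y hy using fun e : m ⟶ c => he (Over.mk e) ((x : ∀ e : m ⟶ c, S.X₂.obj (Over.mk e)) e)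
      (congrFun hx e)
    exact ⟨(y : ∀ e : m ⟶ c, S.X₁.obj (Over.mk e)), funext hy⟩
  · refine (mono_iff_injective_app _).2 fun m x y hxy => ?_
    exact funext fun e => hf (Over.mk e) (congrFun hxy e)
  · refine (epi_iff_surjective_app _).2 fun m x => ?_
    choose y hy using fun e : m ⟶ c => hg (Over.mk e) ((x : ∀ e : m ⟶ c, S.X₃.obj (Over.mk e)) e)
    exact ⟨(y : ∀ e : m ⟶ c, S.X₂.obj (Over.mk e)), funext hy⟩

/-- If `overRan` takes free functors on families of objects of a skeleton of `Over c` to projective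
functors without maps to `Z`, then the image of `overRan` is `Z`-acyclic. -/
lemma subsingleton_ext_overRan (Z : Fun C) {J : Type} (X : J → Over c)
    (hX : ∀ d : Over c, ∃ j, Nonempty (X j ≅ d))
    (hP : ∀ (I : Type) (k : I → J), Projective ((overRan c).obj (freeOn fun i => X (k i))))
    (hZ : ∀ (I : Type) (k : I → J) (f : (overRan c).obj (freeOn fun i => X (k i)) ⟶ Z), f = 0)
    (S : Fun (Over c)) (n : ℕ) : Subsingleton (Ext.{1} ((overRan c).obj S) Z n) := by
  refine subsingleton_ext_of_resolving Z (fun Q => ∃ S, Q = (overRan c).obj S) ?_ n _ ⟨S, rfl⟩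
  rintro _ ⟨S, rfl⟩
  -- One generator for each element of `S` at a skeletal object. The kernel of `π` is again a
  -- functor on `Over c`, so its image stays in the class being resolved.
  let π : freeOn (fun i : Σ j, S.obj (X j) => X i.1) ⟶ S := freeOn.desc fun i => i.2
  have hπ : Epi π := by
    refine (epi_iff_surjective_app _).2 fun d y => ?_
    obtain ⟨j, ⟨f⟩⟩ := hX d
    refine ⟨freeOn.basis (X := fun i : Σ j, S.obj (X j) => X i.1)
      (i := ⟨j, (S.map f.inv).hom y⟩) f.hom, ?_⟩
    rw [freeOn.desc_basis, ← map_comp_apply, f.inv_hom_id, map_id_apply]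
  have hS : (ShortComplex.mk (kernel.ι π) π (kernel.condition π)).ShortExact :=
    { exact := ShortComplex.exact_of_f_is_kernel _ (kernelIsKernel π)
      mono_f := inferInstanceAs (Mono (kernel.ι π))
      epi_g := hπ }
  exact ⟨_, shortExact_map_overRan hS, ⟨_, rfl⟩, hP _ (fun i : Σ j, S.obj (X j) => i.1),
    hZ _ (fun i : Σ j, S.obj (X j) => i.1), rfl⟩

end FunctorCategories

/-! ## Combinatorics of the paracyclic categories -/

namespace InfHom

variable {m n : ℕ+}

lemma intCast_pos (m : ℕ+) : (0 : ℤ) < m := by exact_mod_cast m.pos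

/-- The image of one edge is a path of length at most `n`; this is what makes its edges distinct. -/
lemma toFun_le_add (g : InfHom m n) (s : ℤ) : g.toFun s ≤ g.toFun (s - 1) + n := by
  rw [← g.map_add]
  exact g.monotone (by linarith [intCast_pos m])

/-- The map `a ↦ ⌊(a - s) / m⌋`, which jumps at `s`. -/
def floor (m : ℕ+) (s : ℤ) : InfHom m 1 where
  toFun a := (a - s) / m
  monotone a b h := Int.ediv_le_ediv (intCast_pos m) (by linarith)
  map_add a := by
    rw [show a + (m : ℤ) - s = a - s + m by ring,
      Int.add_ediv_of_dvd_right (dvd_refl _), Int.ediv_self (intCast_pos m).ne']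
    rfl

lemma floor_apply (m : ℕ+) (s a : ℤ) : (floor m s).toFun a = (a - s) / m := rfl

/-- On the period `s ≤ a < s + m` the values of `g` lie in `[t, t + n)`, where the floor is `0`;
periodicity does the rest. -/
lemma comp_floor (g : InfHom m n) {s t : ℤ} (h₁ : g.toFun (s - 1) < t) (h₂ : t ≤ g.toFun s) :
    g.comp (floor n t) = floor m s := by
  ext a
  change (g.toFun a - t) / n = (a - s) / m
  have hm := intCast_pos m
  have hr := Int.emod_nonneg (a - s) hm.ne'
  have hr' := Int.emod_lt_of_pos (a - s) hm
  have ha : a = s + (a - s) % m + (a - s) / m * m := by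
    have := Int.emod_add_mul_ediv (a - s) m
    linarith
  have h₃ : g.toFun s ≤ g.toFun (s + (a - s) % m) := g.monotone (by linarith)
  have h₄ : g.toFun (s + (a - s) % m) ≤ g.toFun (s - 1) + n := by
    rw [← g.map_add]
    exact g.monotone (by linarith)
  have h₅ : (g.toFun (s + (a - s) % m) - t) / n = 0 :=
    Int.ediv_eq_zero_of_lt (by linarith) (by linarith)
  conv_lhs => rw [ha, g.map_add_mul]
  rw [show g.toFun (s + (a - s) % m) + (a - s) / m * n - t =
    g.toFun (s + (a - s) % m) - t + (a - s) / m * n by ring,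
    Int.add_mul_ediv_right _ _ (intCast_pos n).ne', h₅, zero_add]

/-- The jump `s` is the least integer at which `f` is nonnegative; `comp_floor` applies with `t =
0`, as `floor 1 0` is the identity. -/
lemma exists_eq_floor (f : InfHom m 1) : ∃ s, f = floor m s := by
  have hm := intCast_pos m
  have hf (a k : ℤ) : f.toFun (a + k * m) = f.toFun a + k := by
    simpa using f.map_add_mul a k
  obtain ⟨s, hs, hmin⟩ := Int.exists_least_of_bdd (P := fun a => 0 ≤ f.toFun a)
    ⟨(-f.toFun 0 - 1) * m, fun a ha => by
      by_contra hlt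
      have h₁ := f.monotone (not_le.1 hlt).le
      have h₂ := hf 0 (-f.toFun 0 - 1)
      rw [zero_add] at h₂
      linarith⟩
    ⟨(-f.toFun 0) * m, by
      have h₂ := hf 0 (-f.toFun 0)
      rw [zero_add] at h₂
      linarith⟩
  refine ⟨s, ?_⟩
  have h₁ : f.toFun (s - 1) < 0 := by
    by_contra h
    have := hmin _ (not_lt.1 h)
    linarith
  rw [← comp_floor f h₁ hs]
  ext a
  simp [comp, floor]

/-- The map `a ↦ x + a m`. -/
def point (m : ℕ+) (x : ℤ) : InfHom 1 m where
  toFun a := x + a * m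
  monotone a b h := by
    have := mul_le_mul_of_nonneg_right h (intCast_pos m).le
    change x + a * m ≤ x + b * m
    linarith
  map_add a := by
    push_cast
    ring

lemma eq_point (f : InfHom 1 m) : f = point m (f.toFun 0) := by
  ext a
  have h := f.map_add_mul 0 a
  rwa [zero_add, PNat.one_coe, Nat.cast_one, mul_one] at h

/-- The translation `a ↦ a + k`. -/
def translate (m : ℕ+) (k : ℤ) : InfHom m m where
  toFun a := a + k
  monotone a b h := by
    change a + k ≤ b + k
    linarith
  map_add a := by ring

lemma ediv_sub_ediv_le {K : ℤ} (hK : 0 < K) {a b : ℤ} (h : a ≤ b) : b / K - a / K ≤ b - a := by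
  have h₁ : b / K ≤ (a + (b - a) * K) / K := Int.ediv_le_ediv hK (by nlinarith)
  rw [Int.add_mul_ediv_right _ _ hK.ne'] at h₁
  linarith

/-- The map `[j + 1] → [j]` which skips the points congruent to `j`, up to rounding `r`: these are
sent to the next point if `r = 0` and to the previous one if `r = 1`. -/
def collapse (j : ℕ+) (r : ℤ) : InfHom (j + 1) j where
  toFun a := a - (a + r) / (j + 1)
  monotone a b h := by
    have := ediv_sub_ediv_le (K := (j : ℤ) + 1) (by linarith [intCast_pos j])
      (show a + r ≤ b + r by linarith)
    change a - (a + r) / ((j : ℤ) + 1) ≤ b - (b + r) / ((j : ℤ) + 1)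
    linarith
  map_add a := by
    have hj : (j : ℤ) + 1 ≠ 0 := by linarith [intCast_pos j]
    push_cast
    rw [show a + ((j : ℤ) + 1) + r = a + r + 1 * ((j : ℤ) + 1) by ring,
      Int.add_mul_ediv_right _ _ hj]
    ring

lemma collapse_apply (j : ℕ+) (r a : ℤ) :
    (collapse j r).toFun a = a - (a + r) / ((j : ℤ) + 1) := rfl

/-- The inclusion `[j] → [j + 1]` which misses the points congruent to `j`. -/
def skip (j : ℕ+) : InfHom j (j + 1) where
  toFun a := a + a / j
  monotone a b h := by
    have := Int.ediv_le_ediv (intCast_pos j) h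
    change a + a / (j : ℤ) ≤ b + b / (j : ℤ)
    linarith
  map_add a := by
    rw [Int.add_ediv_of_dvd_right (dvd_refl _), Int.ediv_self (intCast_pos j).ne']
    push_cast
    ring

lemma skip_apply (j : ℕ+) (a : ℤ) : (skip j).toFun a = a + a / j := rfl

lemma skip_comp_collapse (j : ℕ+) {r : ℤ} (hr : 0 ≤ r) (hr' : r ≤ 1) (a : ℤ) :
    (collapse j r).toFun ((skip j).toFun a) = a := by
  have hj := intCast_pos j
  have h₁ := Int.emod_nonneg a hj.ne'
  have h₂ := Int.emod_lt_of_pos a hj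
  have h₃ := Int.emod_add_mul_ediv a j
  have h : (a + a / j + r) / ((j : ℤ) + 1) = a / j := by
    rw [show a + a / j + r = (a % j + r) + a / j * ((j : ℤ) + 1) by linarith,
      Int.add_mul_ediv_right _ _ (by linarith),
      Int.ediv_eq_zero_of_lt (by linarith) (by linarith), zero_add]
  rw [collapse_apply, skip_apply, h]
  ring

lemma collapse_apply_sub_one (j : ℕ+) {r : ℤ} (hr : 0 ≤ r) (hr' : r ≤ 1) :
    (collapse j r).toFun (j - 1) = j - 1 := by
  have hj := intCast_pos j
  rw [collapse_apply, Int.ediv_eq_zero_of_lt (by linarith) (by linarith), sub_zero]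

lemma collapse_zero_apply_self (j : ℕ+) : (collapse j 0).toFun j = j := by
  have hj := intCast_pos j
  rw [collapse_apply, Int.ediv_eq_zero_of_lt (by linarith) (by linarith), sub_zero]

lemma collapse_one_apply_self (j : ℕ+) : (collapse j 1).toFun j = j - 1 := by
  have hj := intCast_pos j
  rw [collapse_apply, Int.ediv_self (by linarith)]

/-- The map `[j + 1] → [m]` which extends `f : [j] → [m]` by the value `t` at the new point `j`,
provided that `f (j - 1) ≤ t ≤ f j`. -/
def insert {j : ℕ+} (f : InfHom j m) (t : ℤ) : InfHom (j + 1) m where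
  -- The new value is clamped between two extensions of `f` that agree at the old points. Hence no
  -- condition on `t` is needed for monotonicity, nor for compatibility with composition.
  toFun a := max (f.toFun ((collapse j 1).toFun a))
    (min (f.toFun ((collapse j 0).toFun a)) (t + a / ((j : ℤ) + 1) * m))
  monotone a b h := by
    have hj : (0 : ℤ) < (j : ℤ) + 1 := by linarith [intCast_pos j]
    refine max_le_max (f.monotone ((collapse j 1).monotone h))
      (min_le_min (f.monotone ((collapse j 0).monotone h)) ?_)
    have := mul_le_mul_of_nonneg_right (Int.ediv_le_ediv hj h) (intCast_pos m).le
    linarith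
  map_add a := by
    have hj : (j : ℤ) + 1 ≠ 0 := by linarith [intCast_pos j]
    rw [(collapse j 1).map_add, (collapse j 0).map_add, f.map_add, f.map_add,
      show a + ((j + 1 : ℕ+) : ℤ) = a + 1 * ((j : ℤ) + 1) by push_cast; ring,
      Int.add_mul_ediv_right _ _ hj,
      show t + (a / ((j : ℤ) + 1) + 1) * m = t + a / ((j : ℤ) + 1) * m + m by ring,
      min_add_add_right, max_add_add_right]

section insert

variable {j : ℕ+} (f : InfHom j m)

lemma insert_apply (t a : ℤ) : (f.insert t).toFun a = max (f.toFun ((collapse j 1).toFun a))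
    (min (f.toFun ((collapse j 0).toFun a)) (t + a / ((j : ℤ) + 1) * m)) := rfl

lemma skip_comp_insert (t : ℤ) : (skip j).comp (f.insert t) = f := by
  ext a
  change (f.insert t).toFun ((skip j).toFun a) = f.toFun a
  rw [insert_apply, skip_comp_collapse j zero_le_one le_rfl, skip_comp_collapse j le_rfl zero_le_one]
  exact max_eq_left (min_le_left _ _)

lemma insert_comp (t : ℤ) (g : InfHom m n) :
    (f.insert t).comp g = (f.comp g).insert (g.toFun t) := by
  ext a
  change g.toFun (max _ (min _ _)) = max (g.toFun _) (min (g.toFun _) _)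
  rw [g.monotone.map_max, g.monotone.map_min, g.map_add_mul]

lemma insert_apply_sub_one (t : ℤ) : (f.insert t).toFun (j - 1) = f.toFun (j - 1) := by
  rw [insert_apply, collapse_apply_sub_one j zero_le_one le_rfl,
    collapse_apply_sub_one j le_rfl zero_le_one]
  exact max_eq_left (min_le_left _ _)

lemma insert_apply_self {t : ℤ} (h₁ : f.toFun (j - 1) ≤ t) (h₂ : t ≤ f.toFun j) :
    (f.insert t).toFun j = t := by
  rw [insert_apply, collapse_zero_apply_self, collapse_one_apply_self,
    Int.ediv_eq_zero_of_lt (intCast_pos j).le (by linarith), zero_mul, add_zero, min_eq_right h₂,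
    max_eq_right h₁]

lemma insert_add {f f' : InfHom j m} {c : ℤ} (h : ∀ a, f'.toFun a = f.toFun a + c) (t a : ℤ) :
    (f'.insert (t + c)).toFun a = (f.insert t).toFun a + c := by
  rw [insert_apply, insert_apply, h, h, add_right_comm, min_add_add_right, max_add_add_right]

end insert

end InfHom

/-! ### Vertices and edges of the circle `[m]` -/

section Edges

variable {p : ℕ+}

/-- The morphism of `Λ_p` given by a morphism of `Λ_∞`. -/
def mk (p : ℕ+) {m n : ℕ+} (f : InfHom m n) : (⟨m⟩ : Lambda p) ⟶ ⟨n⟩ := Quotient.mk _ f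

lemma exists_mk {m n : Lambda p} (f : m ⟶ n) : ∃ f' : InfHom m.len n.len, mk p f' = f :=
  Quotient.exists_rep f

lemma mk_comp {l m n : ℕ+} (f : InfHom l m) (g : InfHom m n) :
    mk p f ≫ mk p g = mk p (f.comp g) := rfl

lemma mk_eq_mk_iff {m n : ℕ+} {f g : InfHom m n} :
    mk p f = mk p g ↔ ∃ k : ℤ, ∀ a, g.toFun a = f.toFun a + p * k * n := by
  refine Quotient.eq.trans (exists_congr fun k => forall_congr' fun a => ?_)
  rw [f.map_add_mul]

/-- The morphism `[m] ⟶ [1]` which jumps at `s`. -/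
def edge (p m : ℕ+) (s : ℤ) : (⟨m⟩ : Lambda p) ⟶ objOne p := mk p (InfHom.floor m s)

/-- The morphism `[1] ⟶ [m]` whose image contains `x`. -/
def vertex (p m : ℕ+) (x : ℤ) : objOne p ⟶ (⟨m⟩ : Lambda p) := mk p (InfHom.point m x)

lemma mk_comp_edge {m n : ℕ+} (g : InfHom m n) {s t : ℤ} (h₁ : g.toFun (s - 1) < t)
    (h₂ : t ≤ g.toFun s) : mk p g ≫ edge p n t = edge p m s :=
  congrArg (mk p) (g.comp_floor h₁ h₂)

lemma vertex_comp_mk {m n : ℕ+} (g : InfHom m n) (x : ℤ) :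
    vertex p m x ≫ mk p g = vertex p n (g.toFun x) := by
  refine congrArg (mk p) ?_
  ext a
  exact g.map_add_mul x a

lemma exists_edge {m : ℕ+} (e : (⟨m⟩ : Lambda p) ⟶ objOne p) : ∃ s, edge p m s = e := by
  obtain ⟨f, rfl⟩ := exists_mk e
  obtain ⟨s, rfl⟩ := f.exists_eq_floor
  exact ⟨s, rfl⟩

lemma exists_vertex {m : ℕ+} (x : objOne p ⟶ (⟨m⟩ : Lambda p)) : ∃ s, vertex p m s = x := by
  obtain ⟨f, rfl⟩ := exists_mk x
  exact ⟨_, congrArg (mk p) f.eq_point.symm⟩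

lemma edge_eq_edge_iff {m : ℕ+} {s t : ℤ} :
    edge p m s = edge p m t ↔ ∃ k : ℤ, t = s + p * k * m := by
  have hm := InfHom.intCast_pos m
  refine mk_eq_mk_iff.trans ⟨?_, ?_⟩
  · rintro ⟨k, hk⟩
    refine ⟨-k, ?_⟩
    have h (a : ℤ) : (a - t) / (m : ℤ) = (a - s + p * k * m) / m := by
      have := hk a
      rw [InfHom.floor_apply, InfHom.floor_apply] at this
      rw [Int.add_mul_ediv_right _ _ hm.ne', this]
      simp
    -- Evaluating at the two jumps `t` and `s - p k m` gives the two opposite inequalities.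
    have h₁ := h t
    have h₂ := h (s - p * k * m)
    rw [sub_self, Int.zero_ediv] at h₁
    rw [show s - (p : ℤ) * k * m - s + p * k * m = 0 by ring, Int.zero_ediv] at h₂
    have h₃ := Int.ediv_mul_le (t - s + p * k * m) hm.ne'
    have h₄ := Int.ediv_mul_le (s - p * k * m - t) hm.ne'
    rw [← h₁] at h₃
    rw [h₂] at h₄
    linarith
  · rintro ⟨k, rfl⟩
    refine ⟨-k, fun a => ?_⟩
    rw [InfHom.floor_apply, InfHom.floor_apply,
      show a - (s + p * k * m) = a - s + p * -k * m by ring, Int.add_mul_ediv_right _ _ hm.ne']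
    simp

lemma vertex_eq_vertex_iff {m : ℕ+} {s t : ℤ} :
    vertex p m s = vertex p m t ↔ ∃ k : ℤ, t = s + p * k * m := by
  refine mk_eq_mk_iff.trans (exists_congr fun k => ⟨fun h => ?_, fun h a => ?_⟩)
  · simpa [InfHom.point] using h 0
  · subst h
    simp only [InfHom.point]
    ring

lemma mk_comp_eq_edge_iff {m n : ℕ+} (g : InfHom m n) (e : (⟨n⟩ : Lambda p) ⟶ objOne p) (s : ℤ) :
    mk p g ≫ e = edge p m s ↔ ∃ t, e = edge p n t ∧ g.toFun (s - 1) < t ∧ t ≤ g.toFun s := by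
  have hm := InfHom.intCast_pos m
  have hn := InfHom.intCast_pos n
  constructor
  · intro h
    obtain ⟨t, rfl⟩ := exists_edge e
    obtain ⟨k, hk⟩ := mk_eq_mk_iff.1 h
    have hk' (a : ℤ) : (a - s) / (m : ℤ) = (g.toFun a - (t - p * k * n)) / n := by
      rw [show g.toFun a - (t - p * k * n) = g.toFun a - t + p * k * n by ring,
        Int.add_mul_ediv_right _ _ hn.ne']
      simpa [InfHom.floor, InfHom.comp] using hk a
    -- This lift of the edge makes the two maps agree on `ℤ`, not only modulo `σ ^ p`.
    refine ⟨t - p * k * n, edge_eq_edge_iff.2 ⟨-k, by ring⟩, ?_, ?_⟩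
    · have h₁ := hk' (s - 1)
      rw [show s - 1 - s = -1 by ring] at h₁
      have h₂ := Int.ediv_neg_of_neg_of_pos (show (-1 : ℤ) < 0 by norm_num) hm
      rw [h₁] at h₂
      by_contra h₃
      have := Int.ediv_nonneg (show 0 ≤ g.toFun (s - 1) - (t - p * k * n) by linarith) hn.le
      linarith
    · have h₁ := hk' s
      rw [sub_self, Int.zero_ediv] at h₁
      have := Int.ediv_mul_le (g.toFun s - (t - p * k * n)) hn.ne'
      rw [← h₁] at this
      linarith
  · rintro ⟨t, rfl, h₁, h₂⟩
    exact mk_comp_edge g h₁ h₂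

lemma eq_zero_of_mul_lt {n : ℕ+} {k : ℤ} (h₁ : -(n : ℤ) < p * k * n) (h₂ : p * k * n < (n : ℤ)) :
    k = 0 := by
  have hn := InfHom.intCast_pos n
  have hp := InfHom.intCast_pos p
  have h₃ : -1 < (p : ℤ) * k := by nlinarith
  have h₄ : (p : ℤ) * k < 1 := by nlinarith
  have h₅ : (p : ℤ) * k = 0 := by omega
  exact (mul_eq_zero.1 h₅).resolve_left hp.ne'

/-- Edges repeat with period `p n`, while this half-open interval has length at most `n`. -/
lemma edge_injOn {m n : ℕ+} (g : InfHom m n) (s : ℤ) :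
    Set.InjOn (edge p n) (Finset.Ioc (g.toFun (s - 1)) (g.toFun s) : Set ℤ) := by
  intro t ht t' ht' h
  simp only [Finset.coe_Ioc, Set.mem_Ioc] at ht ht'
  obtain ⟨k, rfl⟩ := edge_eq_edge_iff.1 h
  have hg := g.toFun_le_add s
  have hk : k = 0 := eq_zero_of_mul_lt (p := p) (n := n) (by linarith) (by linarith)
  simp [hk]

instance (m : Lambda p) : Finite (m ⟶ objOne p) := by
  have hm := InfHom.intCast_pos m.len
  have hp := InfHom.intCast_pos p
  refine Finite.of_surjective
    (fun i : Finset.Ico (0 : ℤ) (p * m.len) => edge p m.len i) fun e => ?_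
  obtain ⟨s, rfl⟩ := exists_edge (m := m.len) e
  refine ⟨⟨s % (p * m.len), Finset.mem_Ico.2 ⟨Int.emod_nonneg _ (by positivity),
    Int.emod_lt_of_pos _ (by positivity)⟩⟩, edge_eq_edge_iff.2 ⟨s / (p * m.len), ?_⟩⟩
  have := Int.emod_add_mul_ediv s (p * m.len)
  linarith

instance (m : Lambda p) : Fintype (m ⟶ objOne p) := Fintype.ofFinite _

open Classical in
lemma sum_edges_over {m n : ℕ+} {A : Type*} [AddCommMonoid A] (g : InfHom m n) (s : ℤ)
    (F : ((⟨n⟩ : Lambda p) ⟶ objOne p) → A) :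
    (∑ e, if mk p g ≫ e = edge p m s then F e else 0) =
      ∑ t ∈ Finset.Ioc (g.toFun (s - 1)) (g.toFun s), F (edge p n t) := by
  rw [← Finset.sum_filter, ← Finset.sum_image (g := edge p n) (f := F) (edge_injOn g s)]
  refine Finset.sum_congr ?_ fun _ _ => rfl
  ext e
  simp only [Finset.mem_filter, Finset.mem_univ, true_and, Finset.mem_image, Finset.mem_Ioc]
  rw [mk_comp_eq_edge_iff]
  exact exists_congr fun t => ⟨fun h => ⟨h.2, h.1.symm⟩, fun h => ⟨h.2.symm, h.1⟩⟩

lemma sum_Ioc_sub {A : Type*} [AddCommGroup A] (G : ℤ → A) {a b : ℤ} (h : a ≤ b) :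
    ∑ t ∈ Finset.Ioc a b, (G t - G (t - 1)) = G b - G a := by
  induction b, h using Int.leInduction with
  | base => simp
  | succ b h ih =>
    have : Finset.Ioc a (b + 1) = insert (b + 1) (Finset.Ioc a b) := by
      ext t
      simp only [Finset.mem_insert, Finset.mem_Ioc]
      omega
    rw [this, Finset.sum_insert (by simp), ih, add_sub_cancel_right]
    abel

end Edges

/-! ### Maps out of the Kan extension when its products are finite -/

section

variable {C : Type} [SmallCategory C] {c : C} [∀ m : C, Fintype (m ⟶ c)]

open Classical in
/-- A morphism from `(overRan c).obj S` to `E` given by its components. -/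
def overRanDesc {S : Fun (Over c)} {E : Fun C}
    (L : ∀ {m : C} (e : m ⟶ c), S.obj (Over.mk e) →ₗ[ℤ] E.obj m)
    (hL : ∀ {m m' : C} (g : m ⟶ m') (e : m ⟶ c) (y : S.obj (Over.mk e)),
      ∑ e' : m' ⟶ c, (if h : g ≫ e' = e then
        L e' ((S.map (Over.homMk g h : Over.mk e ⟶ Over.mk e')).hom y) else 0) =
          (E.map g).hom (L e y)) : (overRan c).obj S ⟶ E where
  app m := ModuleCat.ofHom (∑ e : m ⟶ c, L e ∘ₗ
    (LinearMap.proj e : (∀ e : m ⟶ c, S.obj (Over.mk e)) →ₗ[ℤ] S.obj (Over.mk e)))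
  naturality := by
    intro m m' g
    have h (y : ∀ e : m ⟶ c, S.obj (Over.mk e)) :
        (∑ e' : m' ⟶ c, L e' ∘ₗ (LinearMap.proj e' :
          (∀ e : m' ⟶ c, S.obj (Over.mk e)) →ₗ[ℤ] S.obj (Over.mk e')))
            (fun e => (S.map (Over.homMk g : Over.mk (g ≫ e) ⟶ Over.mk e)).hom (y (g ≫ e))) =
          (E.map g).hom ((∑ e : m ⟶ c, L e ∘ₗ
          (LinearMap.proj e : (∀ e : m ⟶ c, S.obj (Over.mk e)) →ₗ[ℤ] S.obj (Over.mk e))) y) := by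
      rw [LinearMap.sum_apply, LinearMap.sum_apply, map_sum]
      refine Eq.trans ?_ (Finset.sum_congr rfl fun e _ => hL g e (y e))
      -- After the exchange, each `e'` lies over exactly one `e`, namely `g ≫ e'`.
      rw [Finset.sum_comm]
      refine Finset.sum_congr rfl fun e' _ => ?_
      rw [Finset.sum_dite_eq, if_pos (Finset.mem_univ _)]
      rfl
    ext y
    exact h y

lemma overRanDesc_apply {S : Fun (Over c)} {E : Fun C}
    (L : ∀ {m : C} (e : m ⟶ c), S.obj (Over.mk e) →ₗ[ℤ] E.obj m) (hL) {m : C}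
    (y : ∀ e : m ⟶ c, S.obj (Over.mk e)) :
    ((overRanDesc (E := E) L hL).app m).hom y = ∑ e, L e (y e) := by
  change (∑ e : m ⟶ c, L e ∘ₗ
    (LinearMap.proj e : (∀ e : m ⟶ c, S.obj (Over.mk e)) →ₗ[ℤ] S.obj (Over.mk e))) y = _
  rw [LinearMap.sum_apply]
  rfl

end

/-! ### The boundary map `B_p` -/

section Connes

variable {p : ℕ+}

/-- The generator of `ℤ_[1]` given by a vertex. -/
def vertexZ (p m : ℕ+) (x : ℤ) : (lowerZ (objOne p)).obj ⟨m⟩ :=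
  (Finsupp.single (vertex p m x) 1 : (objOne p ⟶ (⟨m⟩ : Lambda p)) →₀ ℤ)

lemma lowerZ_map_vertexZ {m n : ℕ+} (g : InfHom m n) (x : ℤ) :
    ((lowerZ (objOne p)).map (mk p g)).hom (vertexZ p m x) = vertexZ p n (g.toFun x) :=
  Finsupp.mapDomain_single.trans (congrArg (fun f => Finsupp.single f 1) (vertex_comp_mk g x))

/-- The boundary of an edge. -/
def boundary {m : Lambda p} (e : m ⟶ objOne p) : (lowerZ (objOne p)).obj m :=
  vertexZ p m.len (exists_edge (m := m.len) e).choose -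
    vertexZ p m.len ((exists_edge (m := m.len) e).choose - 1)

lemma boundary_edge (m : ℕ+) (s : ℤ) :
    boundary (edge p m s) = vertexZ p m s - vertexZ p m (s - 1) := by
  obtain ⟨k, hk⟩ := edge_eq_edge_iff.1 (exists_edge (edge p m s)).choose_spec
  have h₁ : vertexZ p m (exists_edge (edge p m s)).choose = vertexZ p m s :=
    congrArg (fun f => Finsupp.single f (1 : ℤ)) (vertex_eq_vertex_iff.2 ⟨k, hk⟩)
  have h₂ : vertexZ p m ((exists_edge (edge p m s)).choose - 1) = vertexZ p m (s - 1) :=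
    congrArg (fun f => Finsupp.single f (1 : ℤ)) (vertex_eq_vertex_iff.2 ⟨k, by linarith⟩)
  exact congrArg₂ (fun x y => x - y) h₁ h₂

-- Naturality of the boundary: along the path that is the image of an edge, the sum telescopes to
-- the images of its two end points.
open Classical in
lemma sum_boundary_over {m n : ℕ+} (g : InfHom m n) (s : ℤ) :
    (∑ e, if mk p g ≫ e = edge p m s then boundary e else 0) =
      ((lowerZ (objOne p)).map (mk p g)).hom (boundary (edge p m s)) := by
  rw [sum_edges_over]
  refine (Finset.sum_congr rfl fun t _ => boundary_edge n t).trans ?_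
  rw [sum_Ioc_sub (vertexZ p n) (g.monotone (by linarith)), boundary_edge, map_sub,
    lowerZ_map_vertexZ, lowerZ_map_vertexZ]

/-- The map `B_p`, sending a function on the edges to its boundary. -/
def connes (p : ℕ+) : upperZ (objOne p) ⟶ lowerZ (objOne p) :=
  -- By definition `ℤ^o_[1]` is the Kan extension of the constant functor.
  overRanDesc (S := constZ (Over (objOne p)))
    (fun {m} e => (LinearMap.toSpanSingleton ℤ ((lowerZ (objOne p)).obj m) (boundary e) :
      ℤ →ₗ[ℤ] (lowerZ (objOne p)).obj m)) (by
    intro m m' g e y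
    classical
    obtain ⟨g, rfl⟩ := exists_mk g
    obtain ⟨s, rfl⟩ := exists_edge (m := m.len) e
    have h (y : ℤ) : (∑ e', if mk p g ≫ e' = edge p m.len s then y • boundary e' else 0) =
        ((lowerZ (objOne p)).map (mk p g)).hom (y • boundary (edge p m.len s)) := by
      rw [map_smul, ← sum_boundary_over]
      refine Eq.trans ?_ (Finset.smul_sum (r := y)).symm
      refine Finset.sum_congr rfl fun e' _ => ?_
      split_ifs
      · rfl
      · rw [smul_zero]
    exact h y)

lemma connes_apply (m : Lambda p) (y : (m ⟶ objOne p) → ℤ) :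
    ((connes p).app m).hom y = ∑ e, y e • boundary e :=
  overRanDesc_apply _ _ _

end Connes

/-! ### Exactness, as the homology of a circle -/

section Exactness

variable {p : ℕ+}

/-- The coefficient of a vertex. -/
def vertexCoeff (p m : ℕ+) (x : ℤ) : (lowerZ (objOne p)).obj ⟨m⟩ →ₗ[ℤ] ℤ :=
  (Finsupp.lapply (vertex p m x) : ((objOne p ⟶ (⟨m⟩ : Lambda p)) →₀ ℤ) →ₗ[ℤ] ℤ)

open Classical in
lemma vertexCoeff_boundary (m : ℕ+) (x : ℤ) (e : (⟨m⟩ : Lambda p) ⟶ objOne p) :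
    vertexCoeff p m x (boundary e) =
      (if e = edge p m x then 1 else 0) - (if e = edge p m (x + 1) then 1 else 0) := by
  obtain ⟨s, rfl⟩ := exists_edge e
  have h₂ : (vertex p m s = vertex p m x) = (edge p m s = edge p m x) :=
    propext (vertex_eq_vertex_iff.trans edge_eq_edge_iff.symm)
  have h₃ : (vertex p m (s - 1) = vertex p m x) = (edge p m s = edge p m (x + 1)) :=
    propext (vertex_eq_vertex_iff.trans ((exists_congr fun k => by
      constructor <;> intro h <;> linarith).trans edge_eq_edge_iff.symm))
  rw [boundary_edge, map_sub]
  change (Finsupp.single (vertex p m s) (1 : ℤ)) (vertex p m x) -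
    (Finsupp.single (vertex p m (s - 1)) (1 : ℤ)) (vertex p m x) = _
  rw [Finsupp.single_apply, Finsupp.single_apply]
  simp only [h₂, h₃]

/-- The edge `x` ends and the edge `x + 1` starts at the vertex `x`. Hence a cycle takes equal
values on consecutive edges and is constant. -/
lemma vertexCoeff_connes (m : ℕ+) (y : ((⟨m⟩ : Lambda p) ⟶ objOne p) → ℤ) (x : ℤ) :
    vertexCoeff p m x (((connes p).app ⟨m⟩).hom y) =
      y (edge p m x) - y (edge p m (x + 1)) := by
  classical
  have h (e : (⟨m⟩ : Lambda p) ⟶ objOne p) : vertexCoeff p m x (y e • boundary e) =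
      (if e = edge p m x then y e else 0) - (if e = edge p m (x + 1) then y e else 0) := by
    rw [map_smul, vertexCoeff_boundary, smul_eq_mul, mul_sub, mul_ite, mul_ite, mul_one, mul_zero]
  rw [connes_apply, map_sum, Finset.sum_congr rfl fun e _ => h e, Finset.sum_sub_distrib,
    Finset.sum_ite_eq', Finset.sum_ite_eq', if_pos (Finset.mem_univ _), if_pos (Finset.mem_univ _)]

/-- The augmentation, as a linear form. -/
def augZ (m : Lambda p) : (lowerZ (objOne p)).obj m →ₗ[ℤ] ℤ :=
  ((augmentation (objOne p)).app m).hom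

lemma augZ_vertexZ (m : ℕ+) (x : ℤ) : augZ (⟨m⟩ : Lambda p) (vertexZ p m x) = 1 :=
  augmentation_single _ _ _ _

lemma augZ_boundary {m : Lambda p} (e : m ⟶ objOne p) : augZ m (boundary e) = 0 := by
  obtain ⟨s, rfl⟩ := exists_edge (m := m.len) e
  rw [boundary_edge, map_sub, augZ_vertexZ, augZ_vertexZ, sub_self]

open Classical in
/-- The indicator function of an edge. -/
def edgeZ (p m : ℕ+) (s : ℤ) : (upperZ (objOne p)).obj ⟨m⟩ :=
  (Pi.single (edge p m s) 1 : ((⟨m⟩ : Lambda p) ⟶ objOne p) → ℤ)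

lemma connes_edgeZ (m : ℕ+) (s : ℤ) :
    ((connes p).app ⟨m⟩).hom (edgeZ p m s) = vertexZ p m s - vertexZ p m (s - 1) := by
  classical
  refine (connes_apply ⟨m⟩ (Pi.single (edge p m s) (1 : ℤ))).trans ?_
  rw [Finset.sum_eq_single (edge p m s), Pi.single_eq_same, one_smul, boundary_edge]
  · intro e _ he
    rw [Pi.single_eq_of_ne he]
    exact zero_smul _ _
  · exact fun h => absurd (Finset.mem_univ _) h

lemma exists_connes_eq_vertexZ_sub (m : ℕ+) (x : ℤ) :
    ∃ y, ((connes p).app ⟨m⟩).hom y = vertexZ p m x - vertexZ p m 0 := by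
  induction x using Int.induction_on with
  | zero => exact ⟨0, by rw [map_zero, sub_self]⟩
  | succ x ih =>
    obtain ⟨y, hy⟩ := ih
    refine ⟨y + edgeZ p m (x + 1), ?_⟩
    rw [map_add, hy, connes_edgeZ, add_sub_cancel_right]
    abel
  | pred x ih =>
    obtain ⟨y, hy⟩ := ih
    refine ⟨y - edgeZ p m (-x), ?_⟩
    rw [map_sub, hy, connes_edgeZ]
    abel

/-- The circle is connected: every vertex, hence by linearity every 0-chain, can be moved to the
vertex `0` modulo boundaries. -/
lemma exists_connes_eq (m : ℕ+) (z : (lowerZ (objOne p)).obj ⟨m⟩) :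
    ∃ y, ((connes p).app ⟨m⟩).hom y = z - augZ _ z • vertexZ p m 0 := by
  let D : (lowerZ (objOne p)).obj ⟨m⟩ →ₗ[ℤ] (lowerZ (objOne p)).obj ⟨m⟩ :=
    LinearMap.id - (LinearMap.toSpanSingleton ℤ _ (vertexZ p m 0)).comp (augZ ⟨m⟩)
  have h : LinearMap.range D ≤ LinearMap.range ((connes p).app ⟨m⟩).hom := by
    have hs : (⊤ : Submodule ℤ ((lowerZ (objOne p)).obj ⟨m⟩)) =
        Submodule.span ℤ (Set.range (vertexZ p m)) := by
      refine (top_le_iff.1 ?_).symm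
      have h₁ : Submodule.span ℤ (Set.range fun f : objOne p ⟶ (⟨m⟩ : Lambda p) =>
          (Finsupp.single f 1 : (objOne p ⟶ (⟨m⟩ : Lambda p)) →₀ ℤ)) = ⊤ :=
        Finsupp.basisSingleOne.span_eq
      refine h₁.symm.le.trans (Submodule.span_mono ?_)
      rintro _ ⟨f, rfl⟩
      obtain ⟨x, rfl⟩ := exists_vertex f
      exact ⟨x, rfl⟩
    rw [LinearMap.range_eq_map, hs, Submodule.map_span, Submodule.span_le]
    rintro _ ⟨_, ⟨x, rfl⟩, rfl⟩
    obtain ⟨y, hy⟩ := exists_connes_eq_vertexZ_sub (p := p) m x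
    refine ⟨y, hy.trans ?_⟩
    change _ = vertexZ p m x - augZ _ (vertexZ p m x) • vertexZ p m 0
    rw [augZ_vertexZ, one_smul]
  exact h ⟨z, rfl⟩

lemma connes_isExactSequence (p : ℕ+) :
    IsExactSequence (coaugmentation (objOne p)) (connes p) (augmentation (objOne p)) where
  mono := (mono_iff_injective_app _).2 fun m a b h => congrFun h (edge p m.len 0)
  zero₁ := by
    refine fun_hom_ext fun m a => ?_
    refine Finsupp.ext fun f => ?_
    obtain ⟨x, rfl⟩ := exists_vertex (m := m.len) f
    exact (vertexCoeff_connes m.len (fun _ => (a : ℤ)) x).trans (sub_self _)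
  exact₁ := by
    refine (exact_iff_exact_app _).2 fun m y hy => ?_
    have h (y : (m ⟶ objOne p) → ℤ) (hy : ((connes p).app m).hom y = 0) (x : ℤ) :
        y (edge p m.len 0) = y (edge p m.len x) := by
      have hx (x : ℤ) : y (edge p m.len x) = y (edge p m.len (x + 1)) := by
        refine sub_eq_zero.1 ((vertexCoeff_connes m.len y x).symm.trans ?_)
        exact (congrArg (vertexCoeff p m.len x) hy).trans (map_zero _)
      induction x using Int.induction_on with
      | zero => rfl
      | succ x ih => exact ih.trans (hx x)
      | pred x ih => exact ih.trans ((hx _).trans (by rw [sub_add_cancel])).symm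
    refine ⟨(y : (m ⟶ objOne p) → ℤ) (edge p m.len 0), funext fun e => ?_⟩
    obtain ⟨x, rfl⟩ := exists_edge (m := m.len) e
    exact h y hy x
  zero₂ := by
    have h (m : Lambda p) (y : (m ⟶ objOne p) → ℤ) :
        augZ m (((connes p).app m).hom y) = 0 := by
      rw [connes_apply, map_sum]
      refine Finset.sum_eq_zero fun e _ => ?_
      rw [map_smul, augZ_boundary, smul_zero]
    exact fun_hom_ext fun m y => h m y
  exact₂ := by
    refine (exact_iff_exact_app _).2 fun m z hz => ?_
    obtain ⟨y, hy⟩ := exists_connes_eq m.len z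
    refine ⟨y, hy.trans ?_⟩
    have hz' : augZ m z = 0 := hz
    rw [hz', zero_smul, sub_zero]
  epi := (epi_iff_surjective_app _).2 fun m a =>
    ⟨(Finsupp.single (vertex p m.len 0) (a : ℤ) : (objOne p ⟶ m) →₀ ℤ),
      augmentation_single _ _ _ _⟩

end Exactness

/-! ### Adding an end point of an edge to a chain of vertices -/

section Insertion

variable {p : ℕ+} {j m n : ℕ+}

lemma exists_compatible_lift {f : (⟨j⟩ : Lambda p) ⟶ ⟨m⟩} {e : (⟨m⟩ : Lambda p) ⟶ objOne p}
    (h : f ≫ e = edge p j j) : ∃ x : InfHom j m × ℤ, mk p x.1 = f ∧ edge p m x.2 = e ∧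
      x.1.toFun (j - 1) < x.2 ∧ x.2 ≤ x.1.toFun j := by
  obtain ⟨f, rfl⟩ := exists_mk f
  obtain ⟨s, rfl, h₁, h₂⟩ := (mk_comp_eq_edge_iff f e j).1 h
  exact ⟨(f, s), rfl, rfl, h₁, h₂⟩

/-- Let `f : [j] ⟶ [m]` be a chain of vertices which does not cross the edge `e` of `[m]`. The chain
`insertHom h 0` consists of `f` and the end point of `e`, the chain `insertHom h 1` of `f` and the
starting point of `e`. -/
def insertHom {f : (⟨j⟩ : Lambda p) ⟶ ⟨m⟩} {e : (⟨m⟩ : Lambda p) ⟶ objOne p}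
    (h : f ≫ e = edge p j j) (d : ℤ) : (⟨j + 1⟩ : Lambda p) ⟶ ⟨m⟩ :=
  mk p ((exists_compatible_lift h).choose.1.insert ((exists_compatible_lift h).choose.2 - d))

/-- Independence of the chosen lift: since the edge lies in a gap of length at most `m`, two
compatible lifts of chain and edge differ by one common shift, which commutes with insertion. -/
lemma insertHom_mk (f : InfHom j m) {s : ℤ} (h₁ : f.toFun (j - 1) < s) (h₂ : s ≤ f.toFun j)
    (h : mk p f ≫ edge p m s = edge p j j) (d : ℤ) : insertHom h d = mk p (f.insert (s - d)) := by
  obtain ⟨hf, he, h₃, h₄⟩ := (exists_compatible_lift h).choose_spec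
  unfold insertHom
  generalize (exists_compatible_lift h).choose = x at *
  obtain ⟨f', s'⟩ := x
  obtain ⟨k, hk⟩ := mk_eq_mk_iff.1 hf
  obtain ⟨l, hl⟩ := edge_eq_edge_iff.1 he
  have hle := f.toFun_le_add j
  have hj := hk j
  have hj' := hk (j - 1)
  have hlk : l - k = 0 := eq_zero_of_mul_lt (p := p) (n := m) (by dsimp at *; linarith)
    (by dsimp at *; linarith)
  obtain rfl : l = k := by linarith
  refine mk_eq_mk_iff.2 ⟨l, fun a => ?_⟩
  rw [← InfHom.insert_add hk, hl]
  congr 2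
  ring

/-- The inclusion `[j] ⟶ [j + 1]` in `Λ_p`. -/
def skipHom (p j : ℕ+) : (⟨j⟩ : Lambda p) ⟶ ⟨j + 1⟩ := mk p (InfHom.skip j)

lemma skipHom_comp_edge (p j : ℕ+) : skipHom p j ≫ edge p (j + 1) j = edge p j j := by
  have hj := InfHom.intCast_pos j
  refine mk_comp_edge _ ?_ ?_
  · rw [InfHom.skip_apply, Int.ediv_eq_zero_of_lt (by linarith) (by linarith)]
    linarith
  · rw [InfHom.skip_apply, Int.ediv_self hj.ne']
    linarith

lemma skipHom_comp_insertHom {f : (⟨j⟩ : Lambda p) ⟶ ⟨m⟩} {e : (⟨m⟩ : Lambda p) ⟶ objOne p}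
    (h : f ≫ e = edge p j j) (d : ℤ) : skipHom p j ≫ insertHom h d = f :=
  (congrArg (mk p) (InfHom.skip_comp_insert _ _)).trans (exists_compatible_lift h).choose_spec.1

lemma mk_insert_comp_eq_edge_iff (f : InfHom j m) {t : ℤ} (h₁ : f.toFun (j - 1) ≤ t)
    (h₂ : t ≤ f.toFun j) (e : (⟨m⟩ : Lambda p) ⟶ objOne p) :
    mk p (f.insert t) ≫ e = edge p (j + 1) j ↔
      ∃ t', e = edge p m t' ∧ f.toFun (j - 1) < t' ∧ t' ≤ t := by
  rw [mk_comp_eq_edge_iff, f.insert_apply_sub_one, f.insert_apply_self h₁ h₂]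

/-- The paths from the last point of `f` to the end and to the start of `e` differ by the edge `e`
alone. -/
lemma insertHom_zero_comp_eq_edge_iff {f : (⟨j⟩ : Lambda p) ⟶ ⟨m⟩}
    {e : (⟨m⟩ : Lambda p) ⟶ objOne p} (h : f ≫ e = edge p j j)
    (e' : (⟨m⟩ : Lambda p) ⟶ objOne p) :
    insertHom h 0 ≫ e' = edge p (j + 1) j ↔ e' = e ∨ insertHom h 1 ≫ e' = edge p (j + 1) j := by
  obtain ⟨⟨f, s⟩, rfl, rfl, h₁, h₂⟩ := exists_compatible_lift h
  dsimp only at *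
  rw [insertHom_mk f h₁ h₂, insertHom_mk f h₁ h₂, sub_zero,
    mk_insert_comp_eq_edge_iff f h₁.le h₂, mk_insert_comp_eq_edge_iff f (by linarith) (by linarith)]
  constructor
  · rintro ⟨t, rfl, h₃, h₄⟩
    rcases h₄.eq_or_lt with rfl | h₄
    · exact Or.inl rfl
    · exact Or.inr ⟨t, rfl, h₃, by omega⟩
  · rintro (rfl | ⟨t, rfl, h₃, h₄⟩)
    · exact ⟨s, rfl, h₁, le_rfl⟩
    · exact ⟨t, rfl, h₃, by linarith⟩

lemma insertHom_one_comp_ne {f : (⟨j⟩ : Lambda p) ⟶ ⟨m⟩} {e : (⟨m⟩ : Lambda p) ⟶ objOne p}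
    (h : f ≫ e = edge p j j) : insertHom h 1 ≫ e ≠ edge p (j + 1) j := by
  obtain ⟨⟨f, s⟩, rfl, rfl, h₁, h₂⟩ := exists_compatible_lift h
  dsimp only at *
  rw [insertHom_mk f h₁ h₂, Ne, mk_insert_comp_eq_edge_iff f (by linarith) (by linarith)]
  rintro ⟨t, ht, h₃, h₄⟩
  have hs : s = t := edge_injOn (p := p) f j
    (Finset.mem_coe.2 (Finset.mem_Ioc.2 ⟨h₁, h₂⟩))
    (Finset.mem_coe.2 (Finset.mem_Ioc.2 ⟨h₃, by linarith⟩)) ht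
  linarith

open Classical in
/-- The telescoping sum over the edges which are sent to a given edge. -/
lemma sum_insertHom_over {A : Type*} [AddCommGroup A] (F : ((⟨j + 1⟩ : Lambda p) ⟶ ⟨n⟩) → A)
    {f : (⟨j⟩ : Lambda p) ⟶ ⟨m⟩} {e : (⟨m⟩ : Lambda p) ⟶ objOne p} (h : f ≫ e = edge p j j)
    (g : (⟨m⟩ : Lambda p) ⟶ ⟨n⟩)
    (hg : ∀ e' : (⟨n⟩ : Lambda p) ⟶ objOne p, g ≫ e' = e → (f ≫ g) ≫ e' = edge p j j) :
    (∑ e' : (⟨n⟩ : Lambda p) ⟶ objOne p, if h' : g ≫ e' = e then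
      F (insertHom (hg e' h') 0) - F (insertHom (hg e' h') 1) else 0) =
        F (insertHom h 0 ≫ g) - F (insertHom h 1 ≫ g) := by
  obtain ⟨⟨f, s⟩, rfl, rfl, h₁, h₂⟩ := exists_compatible_lift h
  obtain ⟨g, rfl⟩ := exists_mk g
  dsimp only at *
  let G : ((⟨n⟩ : Lambda p) ⟶ objOne p) → A := fun e' => if h' : mk p g ≫ e' = edge p m s then
      F (insertHom (hg e' h') 0) - F (insertHom (hg e' h') 1) else 0
  have e₁ : ∀ e', G e' = if mk p g ≫ e' = edge p m s then G e' else 0 := fun e' => by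
    by_cases h' : mk p g ≫ e' = edge p m s
    · rw [if_pos h']
    · rw [if_neg h']
      exact dif_neg h'
  refine (Finset.sum_congr rfl fun e' _ => e₁ e').trans ?_
  rw [sum_edges_over]
  -- Each edge `t` of the image path contributes the difference of the insertions of `t` and `t -
  -- 1`. The sum leaves those of `g s` and `g (s - 1)`, the images under `g` of the insertions of
  -- `s` and `s - 1`.
  have e₂ : ∀ t ∈ Finset.Ioc (g.toFun (s - 1)) (g.toFun s), G (edge p n t) =
      F (mk p ((f.comp g).insert t)) - F (mk p ((f.comp g).insert (t - 1))) := by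
    intro t ht
    rw [Finset.mem_Ioc] at ht
    have h₃ : (f.comp g).toFun (j - 1) < t :=
      lt_of_le_of_lt (g.monotone (by linarith)) ht.1
    have h₄ : t ≤ (f.comp g).toFun j := ht.2.trans (g.monotone h₂)
    refine (dif_pos (mk_comp_edge g ht.1 ht.2)).trans ?_
    refine congrArg₂ (fun x y => F x - F y) ?_ ?_
    · exact (insertHom_mk (f.comp g) h₃ h₄ _ 0).trans (by rw [sub_zero])
    · exact insertHom_mk (f.comp g) h₃ h₄ _ 1
  rw [Finset.sum_congr rfl e₂, sum_Ioc_sub (fun t => F (mk p ((f.comp g).insert t)))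
    (g.monotone (by linarith)), insertHom_mk f h₁ h₂, insertHom_mk f h₁ h₂, mk_comp, mk_comp,
    InfHom.insert_comp, InfHom.insert_comp, sub_zero]

/-- With rounding `1` the points `j - 1` and `j` merge, so the edge between them becomes an empty
path. -/
lemma mk_collapse_comp_ne (p j : ℕ+) (e : (⟨j⟩ : Lambda p) ⟶ objOne p) :
    mk p (InfHom.collapse j 1) ≫ e ≠ edge p (j + 1) j := by
  rw [Ne, mk_comp_eq_edge_iff, InfHom.collapse_apply_sub_one j zero_le_one le_rfl,
    InfHom.collapse_one_apply_self]
  rintro ⟨t, -, h₁, h₂⟩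
  linarith

end Insertion

/-! ### Acyclicity of `ℤ^o_[1]` -/

section Acyclicity

variable {p : ℕ+}

/-- The objects of a skeleton of `Λ_p / [1]`. -/
def standardEdge (p j : ℕ+) : Over (objOne p) := Over.mk (edge p j j)

/-- A rotation of the circle moves any edge to the standard one. -/
lemma exists_standardEdge_iso (d : Over (objOne p)) :
    ∃ j, Nonempty (standardEdge p j ≅ d) := by
  obtain ⟨s, hs⟩ := exists_edge (m := d.left.len) d.hom
  let m := d.left.len
  let α : (⟨m⟩ : Lambda p) ≅ d.left :=
    { hom := mk p (InfHom.translate m (s - m))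
      inv := mk p (InfHom.translate m (m - s))
      hom_inv_id := congrArg (mk p) (InfHom.ext (funext fun a => by
        simp only [InfHom.comp, InfHom.translate, InfHom.id]
        ring))
      inv_hom_id := congrArg (mk p) (InfHom.ext (funext fun a => by
        simp only [InfHom.comp, InfHom.translate, InfHom.id]
        ring)) }
  refine ⟨m, ⟨Over.isoMk α ?_⟩⟩
  rw [← hs]
  exact mk_comp_edge _ (by simp [InfHom.translate]) (by simp [InfHom.translate])

variable {I : Type} (k : I → ℕ+)

/-- The free functor on a family of standard edges. -/
abbrev freeOver (p : ℕ+) (k : I → ℕ+) : Fun (Over (objOne p)) :=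
  freeOn fun i => standardEdge p (k i)

/-- The free functor on the family of objects `[k i + 1]`. -/
abbrev freeSucc (p : ℕ+) (k : I → ℕ+) : Fun (Lambda p) := freeOn fun i => (⟨k i + 1⟩ : Lambda p)

open Classical in
/-- The element of `(overRan _).obj (freeOver p k)` represented by the chain `[k i] ⟶ [k i + 1]` and
the edge that starts in its last point. -/
def retractionElement (i : I) :
    ∀ e : (⟨k i + 1⟩ : Lambda p) ⟶ objOne p, (freeOver p k).obj (Over.mk e) := fun e =>
  if h : e = edge p (k i + 1) (k i) then
    freeOn.basis (Over.homMk (skipHom p (k i)) (by rw [h]; exact skipHom_comp_edge p (k i)))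
  else 0

/-- The projection of `freeSucc p k` to `(overRan _).obj (freeOver p k)`. -/
def retraction : freeSucc p k ⟶ (overRan (objOne p)).obj (freeOver p k) :=
  freeOn.desc (E := (overRan (objOne p)).obj (freeOver p k)) fun i => retractionElement k i

-- A chain goes to the sum of the edges between its last two points, each paired with the chain
-- without its last point.
open Classical in
lemma retraction_basis {i : I} {m : Lambda p} (f : (⟨k i + 1⟩ : Lambda p) ⟶ m) :
    ((retraction k).app m).hom (freeOn.basis (X := fun i => (⟨k i + 1⟩ : Lambda p)) f) =
      fun e : m ⟶ objOne p => if h : f ≫ e = edge p (k i + 1) (k i) then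
        (freeOn.basis (X := fun i => standardEdge p (k i)) (Over.homMk (skipHom p (k i) ≫ f)
          ((Category.assoc _ _ _).trans ((congrArg (fun x => skipHom p (k i) ≫ x) h).trans
            (skipHom_comp_edge p (k i))))) : (freeOver p k).obj (Over.mk e)) else 0 := by
  have h := freeOn.desc_basis (X := fun i => (⟨k i + 1⟩ : Lambda p))
    (E := (overRan (objOne p)).obj (freeOver p k)) (fun i => retractionElement k i) f
  refine h.trans ?_
  funext e
  refine (overRan_map_apply (freeOver p k) f (retractionElement k i) e).trans ?_
  unfold retractionElement
  split_ifs with h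
  · exact freeOn.map_basis _ _
  · exact map_zero _

/-- The components of the inclusion of `(overRan _).obj (freeOver p k)` into `freeSucc p k`. -/
def sectionComponent {m : Lambda p} (e : m ⟶ objOne p) :
    (freeOver p k).obj (Over.mk e) →ₗ[ℤ] (freeSucc p k).obj m :=
  freeOn.lift (X := fun i => standardEdge p (k i)) fun _ f =>
    freeOn.basis (X := fun i => (⟨k i + 1⟩ : Lambda p)) (insertHom (m := m.len) (Over.w f) 0) -
      freeOn.basis (X := fun i => (⟨k i + 1⟩ : Lambda p)) (insertHom (m := m.len) (Over.w f) 1)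

lemma sectionComponent_basis {m : Lambda p} {e : m ⟶ objOne p} {i : I}
    (f : standardEdge p (k i) ⟶ Over.mk e) :
    sectionComponent k e (freeOn.basis (X := fun i => standardEdge p (k i)) f) =
      freeOn.basis (X := fun i => (⟨k i + 1⟩ : Lambda p)) (insertHom (m := m.len) (Over.w f) 0) -
      freeOn.basis (X := fun i => (⟨k i + 1⟩ : Lambda p)) (insertHom (m := m.len) (Over.w f) 1) :=
  freeOn.lift_basis _ _

-- Naturality of the section; on basis elements it is the telescoping sum `sum_insertHom_over`.
open Classical in
lemma sum_sectionComponent {m m' : Lambda p} (g : m ⟶ m') (e : m ⟶ objOne p) :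
    (∑ e' : m' ⟶ objOne p, if h : g ≫ e' = e then sectionComponent k e' ∘ₗ
      ((freeOver p k).map (Over.homMk g h : Over.mk e ⟶ Over.mk e')).hom else 0) =
        ((freeSucc p k).map g).hom ∘ₗ sectionComponent k e := by
  refine freeOn.linearMap_ext fun i f => ?_
  rw [LinearMap.sum_apply, LinearMap.comp_apply, sectionComponent_basis, map_sub,
    freeOn.map_basis, freeOn.map_basis]
  refine Eq.trans ?_ (sum_insertHom_over (m := m.len) (n := m'.len)
    (fun u => (freeOn.basis (X := fun i => (⟨k i + 1⟩ : Lambda p)) u :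
      (freeSucc p k).obj m')) (Over.w f) g (fun e' h' => by
        subst h'
        exact (Category.assoc _ _ _).trans (Over.w f)))
  refine Finset.sum_congr rfl fun e' _ => ?_
  by_cases h : g ≫ e' = e
  · refine (congrArg (fun φ : (freeOver p k).obj (Over.mk e) →ₗ[ℤ] (freeSucc p k).obj m' =>
      φ (freeOn.basis f)) (dif_pos h)).trans (Eq.trans ?_ (dif_pos h).symm)
    rw [LinearMap.comp_apply, freeOn.map_basis, sectionComponent_basis]
    rfl
  · exact (congrArg (fun φ : (freeOver p k).obj (Over.mk e) →ₗ[ℤ] (freeSucc p k).obj m' =>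
      φ (freeOn.basis f)) (dif_neg h)).trans
        ((LinearMap.zero_apply _).trans (Eq.symm (by exact dif_neg h)))

/-- The inclusion of `(overRan _).obj (freeOver p k)` into `freeSucc p k`. -/
def retractionSection : (overRan (objOne p)).obj (freeOver p k) ⟶ freeSucc p k :=
  overRanDesc (E := freeSucc p k) (fun e => sectionComponent k e) (by
    intro m m' g e y
    classical
    have h := congrArg (fun φ : (freeOver p k).obj (Over.mk e) →ₗ[ℤ] (freeSucc p k).obj m' => φ y)
      (sum_sectionComponent k g e)
    refine Eq.trans ?_ h
    refine Eq.trans ?_ (LinearMap.sum_apply _ _ _).symm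
    refine Finset.sum_congr rfl fun e' _ => ?_
    split_ifs
    · rfl
    · rfl)

-- The path to the end of `e` minus the path to its start is `e`, and both chains restrict to the
-- same `f` along `skipHom`.
open Classical in
lemma retraction_sectionComponent {m : Lambda p} (e : m ⟶ objOne p)
    (y : (freeOver p k).obj (Over.mk e)) :
    ((retraction k).app m).hom (sectionComponent k e y) =
      (Pi.single e y : ∀ e : m ⟶ objOne p, (freeOver p k).obj (Over.mk e)) := by
  have h : ((retraction k).app m).hom ∘ₗ sectionComponent k e =
      (LinearMap.single ℤ (fun e : m ⟶ objOne p => (freeOver p k).obj (Over.mk e)) e :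
        (freeOver p k).obj (Over.mk e) →ₗ[ℤ] ((overRan (objOne p)).obj (freeOver p k)).obj m) := by
    refine freeOn.linearMap_ext fun i f => ?_
    have hf : (freeOn.basis (X := fun i => standardEdge p (k i)) f) =
      freeOn.basis (X := fun i => standardEdge p (k i)) (Over.homMk f.left (Over.w f)) := rfl
    rw [LinearMap.comp_apply, sectionComponent_basis, map_sub, retraction_basis, retraction_basis]
    funext e'
    by_cases he : e' = e
    · subst he
      refine (congrArg₂ (fun a b : (freeOver p k).obj (Over.mk e') => a - b)
        (dif_pos ((insertHom_zero_comp_eq_edge_iff (m := m.len) _ _).2 (Or.inl rfl)))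
        (dif_neg (insertHom_one_comp_ne (m := m.len) _))).trans ?_
      rw [sub_zero]
      refine Eq.trans ?_ (Pi.single_eq_same (M := fun e : m ⟶ objOne p =>
        (freeOver p k).obj (Over.mk e)) e' (freeOn.basis f)).symm
      refine congrArg (fun u => (freeOn.basis (X := fun i => standardEdge p (k i)) u :
        (freeOver p k).obj (Over.mk e'))) (Over.OverMorphism.ext ?_)
      exact skipHom_comp_insertHom (m := m.len) _ _
    · refine Eq.trans ?_ (Pi.single_eq_of_ne (M := fun e : m ⟶ objOne p =>
        (freeOver p k).obj (Over.mk e)) he (freeOn.basis f)).symm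
      refine sub_eq_zero.2 ?_
      by_cases h₁ : insertHom (m := m.len) (Over.w f) 1 ≫ e' = edge p (k i + 1) (k i)
      · refine (dif_pos ((insertHom_zero_comp_eq_edge_iff (m := m.len) _ _).2 (Or.inr h₁))).trans
          (Eq.trans ?_ (dif_pos h₁).symm)
        refine congrArg (fun u => (freeOn.basis (X := fun i => standardEdge p (k i)) u :
          (freeOver p k).obj (Over.mk e'))) (Over.OverMorphism.ext ?_)
        exact (skipHom_comp_insertHom (m := m.len) _ _).trans
          (skipHom_comp_insertHom (m := m.len) _ _).symm
      · exact (dif_neg fun h => h₁ (((insertHom_zero_comp_eq_edge_iff (m := m.len) _ _).1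
          h).resolve_left he)).trans (Eq.symm (by exact dif_neg h₁))
  exact congrArg (fun φ : (freeOver p k).obj (Over.mk e) →ₗ[ℤ]
    ((overRan (objOne p)).obj (freeOver p k)).obj m => φ y) h

lemma retractionSection_comp_retraction :
    retractionSection (p := p) k ≫ retraction k = 𝟙 _ := by
  classical
  have h (m : Lambda p) (y : ∀ e : m ⟶ objOne p, (freeOver p k).obj (Over.mk e)) :
      ((retraction k).app m).hom (((retractionSection k).app m).hom y) = y := by
    refine (congrArg _ (overRanDesc_apply (fun e => sectionComponent k e) _ y)).trans ?_
    rw [map_sum]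
    refine (Finset.sum_congr rfl fun e _ => retraction_sectionComponent k e (y e)).trans ?_
    exact Finset.univ_sum_single y
  exact fun_hom_ext fun m y => h m y

instance projective_overRan_freeOver : Projective ((overRan (objOne p)).obj (freeOver p k)) :=
  Retract.projective ⟨retractionSection k, retraction k, retractionSection_comp_retraction k⟩

/-- A map to a constant functor takes the same value on a generator and on its image under the
collapse of the last two points, and the retraction kills that image. -/
lemma overRan_freeOver_hom_constZ (f : (overRan (objOne p)).obj (freeOver p k) ⟶ constZ _) :
    f = 0 := by
  have h : retraction k ≫ f = 0 := by
    refine freeOn.hom_ext fun i => ?_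
    let κ : (⟨k i + 1⟩ : Lambda p) ⟶ ⟨k i⟩ := mk p (InfHom.collapse (k i) 1)
    let b : (freeSucc p k).obj ⟨k i + 1⟩ := freeOn.basis (𝟙 _)
    have h₁ : ((retraction k ≫ f).app _).hom (((freeSucc p k).map κ).hom b) =
        ((retraction k ≫ f).app _).hom b := naturality_apply (retraction k ≫ f) κ b
    have h₂ : ((retraction k).app _).hom (((freeSucc p k).map κ).hom b) = 0 := by
      rw [freeOn.map_basis, Category.id_comp, retraction_basis]
      exact funext fun e => dif_neg (mk_collapse_comp_ne p (k i) e)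
    refine h₁.symm.trans ?_
    change (f.app _).hom (((retraction k).app _).hom (((freeSucc p k).map κ).hom b)) = 0
    rw [h₂]
    exact map_zero _
  rw [← Category.id_comp f, ← retractionSection_comp_retraction, Category.assoc, h, comp_zero]

/-- The functor `ℤ^o_[1]` is acyclic with respect to `ℤ`. -/
lemma subsingleton_ext_upperZ (p : ℕ+) (n : ℕ) :
    Subsingleton (Ext.{1} (upperZ (objOne p)) (constZ (Lambda p)) n) :=
  subsingleton_ext_overRan (constZ (Lambda p)) (standardEdge p) exists_standardEdge_iso
    (fun _ k => projective_overRan_freeOver k) (fun _ k => overRan_freeOver_hom_constZ k)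
    (constZ (Over (objOne p))) n

end Acyclicity

/-! ### Endomorphisms of the constant functor -/

section DegreeZero

lemma zsmul_id_constZ_bijective (p : ℕ+) :
    Function.Bijective (fun a : ℤ => a • 𝟙 (constZ (Lambda p))) := by
  have h (a x : ℤ) (m : Lambda p) :
      (((a • 𝟙 (constZ (Lambda p)) : constZ (Lambda p) ⟶ constZ (Lambda p)).app m).hom x : ℤ) =
        a * x := by
    rw [NatTrans.app_zsmul]
    rfl
  constructor
  · intro a b hab
    have h' := (h a 1 (objOne p)).symm.trans ((congrArg (fun φ : constZ (Lambda p) ⟶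
      constZ (Lambda p) => ((φ.app (objOne p)).hom (1 : ℤ) : ℤ)) hab).trans (h b 1 (objOne p)))
    exact (mul_one a).symm.trans (h'.trans (mul_one b))
  · intro φ
    refine ⟨((φ.app (objOne p)).hom (1 : ℤ) : ℤ), fun_hom_ext fun m x => ?_⟩
    refine (h _ (x : ℤ) m).trans ?_
    -- Every object receives a map from `[1]`, so all components of `φ` coincide.
    have h₁ : φ.app m = φ.app (objOne p) :=
      (Category.id_comp _).symm.trans
        ((φ.naturality (vertex p m.len 0)).trans (Category.comp_id _))
    rw [h₁]
    let l : ℤ →ₗ[ℤ] ℤ := (φ.app (objOne p)).hom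
    have h₂ (x : ℤ) : l 1 * x = l x := by
      rw [mul_comm, ← smul_eq_mul, ← map_smul, smul_eq_mul, mul_one]
    exact h₂ x

lemma zsmul_mk₀_constZ_bijective (p : ℕ+) :
    Function.Bijective (fun a : ℤ => a • Ext.mk₀.{1} (𝟙 (constZ (Lambda p)))) := by
  have e : (fun a : ℤ => a • Ext.mk₀.{1} (𝟙 (constZ (Lambda p)))) =
      (Ext.addEquiv₀ (X := constZ (Lambda p)) (Y := constZ (Lambda p))).symm ∘
        (fun a : ℤ => a • 𝟙 (constZ (Lambda p))) :=
    funext fun a => (map_zsmul (Ext.addEquiv₀ (X := constZ (Lambda p))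
      (Y := constZ (Lambda p))).symm a (𝟙 _)).symm
  rw [e]
  exact (AddEquiv.bijective _).comp (zsmul_id_constZ_bijective p)

end DegreeZero

/-! ### Restriction along `i_p` -/

section Restriction

variable (p : ℕ+)

/-- The map on edges induced by `i_p`. -/
def edgeMap {m : Lambda p} (e : m ⟶ objOne p) : (cyclicEmbedding p).obj m ⟶ objOne 1 :=
  (cyclicEmbedding p).map e ≫ edge 1 (1 * p) 0

/-- The map on vertices induced by `i_p`. -/
def vertexMap {m : Lambda p} (x : objOne p ⟶ m) : objOne 1 ⟶ (cyclicEmbedding p).obj m :=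
  vertex 1 (1 * p) 0 ≫ (cyclicEmbedding p).map x

lemma edgeMap_comp {m m' : Lambda p} (g : m ⟶ m') (e : m' ⟶ objOne p) :
    (cyclicEmbedding p).map g ≫ edgeMap p e = edgeMap p (g ≫ e) :=
  (Category.assoc _ _ _).symm.trans
    (congrArg (· ≫ edge 1 (1 * p) 0) ((cyclicEmbedding p).map_comp g e).symm)

lemma vertexMap_comp {m m' : Lambda p} (x : objOne p ⟶ m) (g : m ⟶ m') :
    vertexMap p (x ≫ g) = vertexMap p x ≫ (cyclicEmbedding p).map g :=
  (congrArg (vertex 1 (1 * p) 0 ≫ ·) ((cyclicEmbedding p).map_comp x g)).trans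
    (Category.assoc _ _ _).symm

lemma edgeMap_edge (m : ℕ+) (s : ℤ) : edgeMap p (edge p m s) = edge 1 (m * p) s := by
  have hm := InfHom.intCast_pos m
  refine mk_comp_edge ((InfHom.floor m s).scale p) ?_ ?_
  · change (s - 1 - s) / (m : ℤ) < 0
    exact Int.ediv_neg_of_neg_of_pos (by linarith) hm
  · change 0 ≤ (s - s) / (m : ℤ)
    simp

lemma vertexMap_vertex (m : ℕ+) (x : ℤ) : vertexMap p (vertex p m x) = vertex 1 (m * p) x := by
  refine (vertex_comp_mk ((InfHom.point m x).scale p) 0).trans (congrArg _ ?_)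
  change x + 0 * (m : ℤ) = x
  ring

/-- The circles `[m]` in `Λ_p` and `[mp]` in `Λ` have the same period, so integer labels identify
their vertices and edges. -/
lemma period_iff (m : ℕ+) (s t : ℤ) : (∃ k : ℤ, t = s + ((1 : ℕ+) : ℤ) * k * ((m * p : ℕ+) : ℤ)) ↔
    ∃ k : ℤ, t = s + p * k * m := by
  refine exists_congr fun k => ?_
  push_cast
  rw [show (1 : ℤ) * k * (m * p) = p * k * m by ring]

lemma edgeMap_bijective (m : Lambda p) : Function.Bijective (edgeMap p (m := m)) := by
  constructor
  · intro e e' h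
    obtain ⟨s, rfl⟩ := exists_edge (m := m.len) e
    obtain ⟨t, rfl⟩ := exists_edge (m := m.len) e'
    exact edge_eq_edge_iff.2 ((period_iff p m.len s t).1 (edge_eq_edge_iff.1
      ((edgeMap_edge p m.len s).symm.trans (h.trans (edgeMap_edge p m.len t)))))
  · intro e
    obtain ⟨s, rfl⟩ := exists_edge (m := m.len * p) e
    exact ⟨edge p m.len s, edgeMap_edge p m.len s⟩

lemma vertexMap_bijective (m : Lambda p) : Function.Bijective (vertexMap p (m := m)) := by
  constructor
  · intro x y h
    obtain ⟨s, rfl⟩ := exists_vertex (m := m.len) x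
    obtain ⟨t, rfl⟩ := exists_vertex (m := m.len) y
    exact vertex_eq_vertex_iff.2 ((period_iff p m.len s t).1 (vertex_eq_vertex_iff.1
      ((vertexMap_vertex p m.len s).symm.trans (h.trans (vertexMap_vertex p m.len t)))))
  · intro x
    obtain ⟨s, rfl⟩ := exists_vertex (m := m.len * p) x
    exact ⟨vertex p m.len s, vertexMap_vertex p m.len s⟩

/-- The comparison map `i_p^* ℤ^o_[1] ⟶ ℤ^o_[1]`. -/
def upperComparison :
    (restriction (cyclicEmbedding p)).obj (upperZ (objOne 1)) ⟶ upperZ (objOne p) where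
  app m := ModuleCat.ofHom (LinearMap.funLeft ℤ ℤ (edgeMap p (m := m)))
  naturality m m' g := by
    ext y
    funext e
    exact congrArg y (edgeMap_comp p g e)

/-- The comparison map `ℤ_[1] ⟶ i_p^* ℤ_[1]`. -/
def lowerComparison :
    lowerZ (objOne p) ⟶ (restriction (cyclicEmbedding p)).obj (lowerZ (objOne 1)) where
  app m := ModuleCat.ofHom (Finsupp.lmapDomain ℤ ℤ (vertexMap p (m := m)))
  naturality m m' g := by
    ext : 1
    refine Finsupp.lhom_ext fun f n => ?_
    change Finsupp.mapDomain (vertexMap p) (Finsupp.mapDomain (fun f => f ≫ g)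
      (Finsupp.single f n)) = Finsupp.mapDomain (fun f => f ≫ (cyclicEmbedding p).map g)
        (Finsupp.mapDomain (vertexMap p) (Finsupp.single f n))
    simp only [Finsupp.mapDomain_single, vertexMap_comp]

instance : IsIso (lowerComparison p) :=
  isIso_of_bijective_app _ fun m =>
    ⟨Finsupp.mapDomain_injective (vertexMap_bijective p m).1,
      Finsupp.mapDomain_surjective (vertexMap_bijective p m).2⟩

lemma lowerComparison_vertexZ (m : ℕ+) (x : ℤ) :
    ((lowerComparison p).app ⟨m⟩).hom (vertexZ p m x) = vertexZ 1 (m * p) x :=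
  Finsupp.mapDomain_single.trans (congrArg (fun f => Finsupp.single f 1) (vertexMap_vertex p m x))

lemma lowerComparison_boundary {m : Lambda p} (e : m ⟶ objOne p) :
    ((lowerComparison p).app m).hom (boundary e) = boundary (edgeMap p e) := by
  obtain ⟨s, rfl⟩ := exists_edge (m := m.len) e
  rw [boundary_edge, edgeMap_edge]
  refine Eq.trans ?_ (boundary_edge (m.len * p) s).symm
  rw [map_sub, lowerComparison_vertexZ, lowerComparison_vertexZ]
  rfl

/-- The comparison maps for edges and for vertices go in opposite directions, so compatibility with
the boundary is a factorization and needs no inverse. -/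
lemma upperComparison_comp_connes_comp :
    upperComparison p ≫ connes p ≫ lowerComparison p =
      (restriction (cyclicEmbedding p)).map (connes 1) := by
  have h (m : Lambda p) (y : ((cyclicEmbedding p).obj m ⟶ objOne 1) → ℤ) :
      ((lowerComparison p).app m).hom (((connes p).app m).hom fun e => y (edgeMap p e)) =
        ((connes 1).app ((cyclicEmbedding p).obj m)).hom y := by
    refine Eq.trans ?_ (connes_apply ((cyclicEmbedding p).obj m) y).symm
    rw [connes_apply, map_sum, ← (edgeMap_bijective p m).sum_comp]
    refine Finset.sum_congr rfl fun e _ => ?_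
    rw [map_smul, lowerComparison_boundary]
  exact fun_hom_ext fun m y => h m y

lemma lowerComparison_comp_augmentation :
    lowerComparison p ≫ (restriction (cyclicEmbedding p)).map (augmentation (objOne 1)) =
      augmentation (objOne p) := by
  ext m : 3
  refine Finsupp.lhom_ext fun f n => ?_
  refine Eq.trans ?_ (augmentation_single (objOne p) m f n).symm
  refine Eq.trans ?_ (augmentation_single (objOne 1) _ (vertexMap p f) n)
  exact congrArg ((augmentation (objOne 1)).app ((cyclicEmbedding p).obj m)).hom
    Finsupp.mapDomain_single

lemma mapExactFunctor_yonedaClass_connes :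
    ((connes_isExactSequence 1).yonedaClass.mapExactFunctor (restriction (cyclicEmbedding p)) :
      Ext.{1} (constZ (Lambda p)) (constZ (Lambda p)) 2) =
        (connes_isExactSequence p).yonedaClass :=
  (connes_isExactSequence 1).mapExactFunctor_yonedaClass (restriction (cyclicEmbedding p))
    (connes_isExactSequence p) (upperComparison p) (inv (lowerComparison p)) rfl
    (by rw [IsIso.eq_comp_inv, Category.assoc, upperComparison_comp_connes_comp])
    ((IsIso.inv_comp_eq _).2 (lowerComparison_comp_augmentation p).symm)

end Restriction

end Paracyclic

end

theorem lemma1p3 :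
    ∃ (B : ∀ p : ℕ+, Paracyclic.upperZ (Paracyclic.objOne p) ⟶
          Paracyclic.lowerZ (Paracyclic.objOne p))
      (hB : ∀ p : ℕ+, Paracyclic.IsExactSequence
          (Paracyclic.coaugmentation (Paracyclic.objOne p)) (B p)
          (Paracyclic.augmentation (Paracyclic.objOne p))),
      (∀ p : ℕ+, Function.Bijective
        (Polynomial.aeval (R := ℤ) (Paracyclic.ofDegree 2 (hB p).yonedaClass) :
          Polynomial ℤ → Paracyclic.cohomologyRing (Paracyclic.Lambda p))) ∧
      (∀ p : ℕ+, Paracyclic.restrictCohomology (Paracyclic.cyclicEmbedding p)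
          (Paracyclic.ofDegree 2 (hB 1).yonedaClass) =
        Paracyclic.ofDegree 2 (hB p).yonedaClass) := by
  open Paracyclic in
  refine ⟨connes, connes_isExactSequence, fun p => ?_, fun p => ?_⟩
  -- Positive `Ext` out of the projective `ℤ_[1]` vanishes, which is all the splicing asks of this
  -- term.
  · have hL (n : ℕ) : Subsingleton
        (Ext.{1} (lowerZ (objOne p)) (constZ (Lambda p)) (n + 1)) :=
      Ext.subsingleton_of_projective _ _ _
    exact aeval_bijective_of_comp_bijective (connes_isExactSequence p).yonedaClass
      (fun n m h => (connes_isExactSequence p).yonedaClass_comp_bijective _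
        (subsingleton_ext_upperZ p) hL n m h)
      (zsmul_mk₀_constZ_bijective p)
      ((connes_isExactSequence p).subsingleton_ext_one _ (subsingleton_ext_upperZ p 0) (hL 0))
  · refine (DirectSum.toSemiring_of _ _ _ _ _).trans ?_
    exact congrArg (DirectSum.of (SelfExt.{1} (constZ (Lambda p))) 2)
      (mapExactFunctor_yonedaClass_connes p)
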